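/- For every integer $n \ge 1$ let $\Xi_n$ be a Poisson point process with intensity $n$ in the unit square $[0,1]^2$, i.e. with intensity measure $n$ times Lebesgue measure on $[0,1]^2$; the processes for different $n$ may live on different probability spaces. Let $\ell(n)$ be the greatest number of points of $\Xi_n$ that an increasing path can go through, i.e. the largest $L$ for which there are points $(x_1,y_1),\dots,(x_L,y_L)\in\Xi_n$ with $x_1<\dots<x_L$ and $y_1<\dots<y_L$. Then $$\frac{\ell(n)}{\sqrt n}\longrightarrow 2\ \text{ in probability as } n\to\infty,$$ and moreover $\ell(n)$ is integrable for every $n$ and $\mathbb{E}[\ell(n)]/\sqrt n\to 2$. Consequently the Ulam constant is $c=2$: if $\sigma_n$ is a uniformly random permutation of $\{1,\dots,n\}$ and $\ell(\sigma_n)$ denotes the length of its longest increasing subsequence, then $\ell(\sigma_n)/\sqrt n\to 2$ in probability as $n\to\infty$, i.e. for every $\varepsilon>0$, $$\frac{\#\{\sigma\in S_n : |\ell(\sigma)/\sqrt n-2|\ge\varepsilon\}}{n!}\longrightarrow 0 .$$ -/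

import Mathlib

open MeasureTheory ProbabilityTheory Filter Topology

/-- `Ξ` is (the random set of points of) a Poisson point process on `E` with intensity measure `ν`,
defined on the probability space `(Ω, P)`: the number of points in every measurable set `B` is a
random variable, it has the Poisson distribution of parameter `ν B` when `ν B` is finite, and the
numbers of points in finitely many pairwise disjoint measurable sets are independent. -/
structure IsPoissonProcess {Ω E : Type*} [MeasurableSpace Ω] [MeasurableSpace E]
    (P : Measure Ω) (Ξ : Ω → Set E) (ν : Measure E) : Prop where
  measurable_count : ∀ B : Set E, MeasurableSet B → Measurable (fun ω => (Ξ ω ∩ B).encard)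
  map_count : ∀ B : Set E, MeasurableSet B → ν B ≠ ⊤ →
    P.map (fun ω => (Ξ ω ∩ B).encard) =
      (poissonMeasure (ν B).toNNReal).map (fun k : ℕ => (k : ℕ∞))
  indep_count : ∀ (k : ℕ) (B : Fin k → Set E), (∀ i, MeasurableSet (B i)) →
    Pairwise (fun i j => Disjoint (B i) (B j)) →
    iIndepFun (fun i ω => (Ξ ω ∩ B i).encard) P

/-- Lebesgue measure on the unit square `[0,1] × [0,1]`, multiplied by `n`. -/
noncomputable def squareIntensity (n : ℕ) : Measure (ℝ × ℝ) :=
  (n : ENNReal) • volume.restrict (Set.Icc (0 : ℝ) 1 ×ˢ Set.Icc (0 : ℝ) 1)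

/-- The greatest number of points of `S` on an increasing path, i.e. the largest size of a subset
of `S` any two distinct points of which are strictly increasing in both coordinates (in one order).
It is infinite if there is no largest size. -/
noncomputable def increasingHeight (S : Set (ℝ × ℝ)) : ℕ∞ :=
  S.chainHeight (fun x y => x.1 < y.1 ∧ x.2 < y.2)

/-- `increasingHeight` as a real number. The value for an infinite height is irrelevant here, since
the point processes considered have almost surely finitely many points. -/
noncomputable def longestIncreasingPath (S : Set (ℝ × ℝ)) : ℝ :=
  ((increasingHeight S).toNat : ℝ)

open Classical in
/-- The length of the longest increasing subsequence of the permutation `σ`. -/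
noncomputable def longestIncreasingSubsequence {n : ℕ} (σ : Equiv.Perm (Fin n)) : ℕ :=
  ((Finset.univ : Finset (Finset (Fin n))).filter
    (fun s : Finset (Fin n) => StrictMonoOn σ (s : Set (Fin n)))).sup Finset.card

/-! The model is a discrete Hammersley process: an N × N grid of independent Bernoulli(p) cells,
with Bernoulli sources on the horizontal axis and sinks on the vertical axis. The increments of the
last passage values are 0 or 1 and evolve by a local rule. This rule preserves independent Bernoulli
increments as soon as the odds of sources and sinks multiply to p (`integral_localStep`). Running it
over the grid cell by cell shows that the exits on the right have the law of the sinks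
(`BalancedWeights.integral_exits`). The passage value to the corner is therefore a sum of two
Bernoulli sums, of known mean and concentrated by Chebyshev. With odds q = √p on both axes the mean
is at most 2qN, and close to it for small q.

Dropping the boundary only lowers the passage value, which gives the upper bounds. For the lower
bound, an optimal path must be shown to collect little on the axes. Multiplying the source odds by
1+δ and dividing the sink odds by 1+δ raises the mean only by order δ²qN, because θ + 1/θ is
stationary at θ = 1. A path leaving the horizontal axis after 3δN would gain about 3δ²qN from the
additional sources. Late exits are thus unlikely (`measureReal_exitsFrom_diag_le`), and the bulk
alone reaches (2 - 6δ)qN (`measureReal_gridHeight_le_le`).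

For the Poisson process, the occupied dyadic cells of level k form such a field with qN → √n and q →
0, and the grid heights increase with k to the longest increasing path (`increasingHeight_eq_iSup`).
All bounds pass to the limit, including the bound 2√n for the mean.

Permutations are compared directly with Bernoulli fields on a grid of side n³ with about (1 ± δ)n
true cells. With high probability no two of these share a row or column. The law of the field is
invariant under permuting rows, so the order pattern of n such cells may be taken uniform
(`permFraction_mul_measureReal_le`). -/

/-- Last passage values on the quadrant for the field `ξ`, with sources `s` on the horizontal axis
and sinks `t` on the vertical axis. -/
def lpp (s t : ℕ → Bool) (ξ : ℕ → ℕ → Bool) : ℕ → ℕ → ℕ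
  | 0, 0 => 0
  | i + 1, 0 => lpp s t ξ i 0 + (s i).toNat
  | 0, j + 1 => lpp s t ξ 0 j + (t j).toNat
  | i + 1, j + 1 =>
    max (max (lpp s t ξ (i + 1) j) (lpp s t ξ i (j + 1))) (lpp s t ξ i j + (ξ i j).toNat)
  termination_by i j => i + j

/-! ### Deterministic last passage percolation with sources and sinks -/

section LastPassage

variable (s t : ℕ → Bool) (ξ : ℕ → ℕ → Bool)

lemma lpp_zero_zero : lpp s t ξ 0 0 = 0 := by rw [lpp]

lemma lpp_succ_zero (i : ℕ) : lpp s t ξ (i + 1) 0 = lpp s t ξ i 0 + (s i).toNat := by rw [lpp]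

lemma lpp_zero_succ (j : ℕ) : lpp s t ξ 0 (j + 1) = lpp s t ξ 0 j + (t j).toNat := by rw [lpp]

lemma lpp_succ_succ (i j : ℕ) : lpp s t ξ (i + 1) (j + 1) =
    max (max (lpp s t ξ (i + 1) j) (lpp s t ξ i (j + 1))) (lpp s t ξ i j + (ξ i j).toNat) := by
  rw [lpp]

lemma lpp_zero_right (i : ℕ) : lpp s t ξ i 0 = ∑ k ∈ Finset.range i, (s k).toNat := by
  induction i with
  | zero => simp [lpp_zero_zero]
  | succ i ih => rw [lpp_succ_zero, Finset.sum_range_succ, ih]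

lemma lpp_zero_left (j : ℕ) : lpp s t ξ 0 j = ∑ k ∈ Finset.range j, (t k).toNat := by
  induction j with
  | zero => simp [lpp_zero_zero]
  | succ i ih => rw [lpp_zero_succ, Finset.sum_range_succ, ih]

lemma lpp_le_succ_left (i j : ℕ) : lpp s t ξ i j ≤ lpp s t ξ (i + 1) j := by
  cases j with
  | zero => simp [lpp_succ_zero]
  | succ j => rw [lpp_succ_succ]; omega

lemma lpp_le_succ_right (i j : ℕ) : lpp s t ξ i j ≤ lpp s t ξ i (j + 1) := by
  cases i with
  | zero => simp [lpp_zero_succ]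
  | succ j => rw [lpp_succ_succ]; omega

/-- By induction on the row, each of the three candidates in the recursion exceeds the left
neighbour by at most one. Increments are therefore Boolean. -/
lemma lpp_succ_left_le (i j : ℕ) : lpp s t ξ (i + 1) j ≤ lpp s t ξ i j + 1 := by
  induction j with
  | zero => have := Bool.toNat_le (s i); rw [lpp_succ_zero]; omega
  | succ j ih =>
    have := Bool.toNat_le (ξ i j)
    have := lpp_le_succ_right s t ξ i j
    rw [lpp_succ_succ]; omega

lemma lpp_succ_right_le (i j : ℕ) : lpp s t ξ i (j + 1) ≤ lpp s t ξ i j + 1 := by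
  induction i with
  | zero => have := Bool.toNat_le (t j); rw [lpp_zero_succ]; omega
  | succ i ih =>
    have := Bool.toNat_le (ξ i j)
    have := lpp_le_succ_left s t ξ i j
    rw [lpp_succ_succ]; omega

lemma lpp_mono_right (i : ℕ) {j j' : ℕ} (h : j ≤ j') : lpp s t ξ i j ≤ lpp s t ξ i j' :=
  monotone_nat_of_le_succ (fun j => lpp_le_succ_right s t ξ i j) h

/-- Whether the last passage value increases when moving from column `i` to column `i + 1`. -/
def lppX (i j : ℕ) : Bool := decide (lpp s t ξ i j < lpp s t ξ (i + 1) j)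

/-- Whether the last passage value increases when moving from row `j` to row `j + 1`. -/
def lppY (i j : ℕ) : Bool := decide (lpp s t ξ i j < lpp s t ξ i (j + 1))

lemma lppX_toNat (i j : ℕ) :
    lpp s t ξ (i + 1) j = lpp s t ξ i j + (lppX s t ξ i j).toNat := by
  have h1 := lpp_le_succ_left s t ξ i j
  have h2 := lpp_succ_left_le s t ξ i j
  by_cases h : lpp s t ξ i j < lpp s t ξ (i + 1) j <;> simp [lppX, h] <;> omega

lemma lppY_toNat (i j : ℕ) :
    lpp s t ξ i (j + 1) = lpp s t ξ i j + (lppY s t ξ i j).toNat := by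
  have h1 := lpp_le_succ_right s t ξ i j
  have h2 := lpp_succ_right_le s t ξ i j
  by_cases h : lpp s t ξ i j < lpp s t ξ i (j + 1) <;> simp [lppY, h] <;> omega

lemma lppX_zero (i : ℕ) : lppX s t ξ i 0 = s i := by
  cases h : s i <;> simp [lppX, lpp_succ_zero, h]

lemma lppY_zero (j : ℕ) : lppY s t ξ 0 j = t j := by
  cases h : t j <;> simp [lppY, lpp_zero_succ, h]

/-- Around one unit cell the recursion involves only differences: with bottom increment a, left
increment b and cell value c, the top increment is max(a, b, c) - b. With `lppY_succ`, increments
thus evolve on their own, without reference to the passage values. -/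
lemma lppX_succ (i j : ℕ) : lppX s t ξ i (j + 1) =
    (!lppY s t ξ i j && (lppX s t ξ i j || ξ i j)) := by
  have h1 := lppX_toNat s t ξ i j
  have h2 := lppY_toNat s t ξ i j
  have h3 := lppX_toNat s t ξ i (j + 1)
  have h4 := lpp_succ_succ s t ξ i j
  revert h1 h2 h3 h4
  generalize lppX s t ξ i j = a
  generalize lppY s t ξ i j = b
  generalize lppX s t ξ i (j + 1) = a'
  generalize ξ i j = c
  cases a <;> cases b <;> cases c <;> cases a' <;> simp <;> omega

lemma lppY_succ (i j : ℕ) : lppY s t ξ (i + 1) j =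
    (!lppX s t ξ i j && (lppY s t ξ i j || ξ i j)) := by
  have h1 := lppX_toNat s t ξ i j
  have h2 := lppY_toNat s t ξ i j
  have h3 := lppY_toNat s t ξ (i + 1) j
  have h4 := lpp_succ_succ s t ξ i j
  revert h1 h2 h3 h4
  generalize lppX s t ξ i j = a
  generalize lppY s t ξ i j = b
  generalize lppY s t ξ (i + 1) j = a'
  generalize ξ i j = c
  cases a <;> cases b <;> cases c <;> cases a' <;> simp <;> omega

/-- The passage value is the sum of increments along the bottom edge and then up column `i`. At the
corner these are the sources and the exits on the right. -/
lemma lpp_eq_sum_add_sum (i j : ℕ) : lpp s t ξ i j =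
    ∑ k ∈ Finset.range i, (s k).toNat + ∑ k ∈ Finset.range j, (lppY s t ξ i k).toNat := by
  induction j with
  | zero => simp [lpp_zero_right]
  | succ j ih => rw [lppY_toNat, ih, Finset.sum_range_succ, add_assoc]

lemma lpp_swap (i j : ℕ) : lpp t s (fun a b => ξ b a) j i = lpp s t ξ i j := by
  induction i generalizing j with
  | zero => rw [lpp_zero_right, lpp_zero_left]
  | succ i ih =>
    induction j with
    | zero => rw [lpp_zero_right, lpp_zero_left]
    | succ j ihj => rw [lpp_succ_succ, lpp_succ_succ, ihj, ih, ih, max_comm (lpp s t ξ i (j + 1))]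

variable {s t ξ}

lemma lpp_mono_field {ξ' : ℕ → ℕ → Bool} (h : ∀ i j, ξ i j = true → ξ' i j = true) (i j : ℕ) :
    lpp s t ξ i j ≤ lpp s t ξ' i j := by
  induction i generalizing j with
  | zero => rw [lpp_zero_left, lpp_zero_left]
  | succ i ih =>
    induction j with
    | zero => rw [lpp_zero_right, lpp_zero_right]
    | succ j ihj =>
      have h1 : (ξ i j).toNat ≤ (ξ' i j).toNat := by
        have := h i j
        cases h2 : ξ i j <;> simp_all
      have h2 := ih j
      have h3 := ih (j + 1)
      rw [lpp_succ_succ, lpp_succ_succ]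
      omega

variable (ξ) in
/-- The last passage values of the field `ξ` without sources and sinks. -/
def bulk : ℕ → ℕ → ℕ := lpp (fun _ => false) (fun _ => false) ξ

variable (ξ) in
/-- The part of the field `ξ` in the columns from `k` on. -/
def fieldFrom (k : ℕ) : ℕ → ℕ → Bool := fun i j => decide (k ≤ i) && ξ i j

lemma bulk_zero_left (j : ℕ) : bulk ξ 0 j = 0 := by simp [bulk, lpp_zero_left]

lemma bulk_zero_right (i : ℕ) : bulk ξ i 0 = 0 := by simp [bulk, lpp_zero_right]

lemma bulk_succ_succ (i j : ℕ) : bulk ξ (i + 1) (j + 1) =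
    max (max (bulk ξ (i + 1) j) (bulk ξ i (j + 1))) (bulk ξ i j + (ξ i j).toNat) :=
  lpp_succ_succ _ _ _ i j

lemma bulk_mono_field {ξ' : ℕ → ℕ → Bool} (h : ∀ i j, ξ i j = true → ξ' i j = true) (i j : ℕ) :
    bulk ξ i j ≤ bulk ξ' i j := lpp_mono_field h i j

lemma bulk_swap (i j : ℕ) : bulk (fun a b => ξ b a) j i = bulk ξ i j := lpp_swap _ _ _ i j

lemma bulk_fieldFrom_le (k i j : ℕ) : bulk (fieldFrom ξ k) i j ≤ bulk ξ i j :=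
  bulk_mono_field (fun i j h => by simp [fieldFrom] at h; exact h.2) i j

lemma bulk_fieldFrom_eq_zero {k i : ℕ} (h : i ≤ k) (j : ℕ) : bulk (fieldFrom ξ k) i j = 0 := by
  induction i generalizing j with
  | zero => exact bulk_zero_left j
  | succ i ih =>
    induction j with
    | zero => exact bulk_zero_right _
    | succ j ihj =>
      rw [bulk_succ_succ, ihj, ih (by omega), ih (by omega)]
      simp [fieldFrom]; omega

variable (s t ξ) in
/-- A path may collect the first `k` sources and then go through the columns from `k` on. -/
lemma sum_add_bulk_fieldFrom_le (k i j : ℕ) :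
    ∑ l ∈ Finset.range (min k i), (s l).toNat + bulk (fieldFrom ξ k) i j ≤ lpp s t ξ i j := by
  induction i generalizing j with
  | zero => simp [bulk_zero_left]
  | succ i ih =>
    induction j with
    | zero =>
      rw [bulk_zero_right, lpp_zero_right, add_zero]
      exact Finset.sum_le_sum_of_subset (Finset.range_mono (by omega))
    | succ j ihj =>
      -- Left of column `k` the truncated field is empty, so only the sources count.
      rcases Nat.lt_or_ge i k with hik | hik
      · rw [bulk_fieldFrom_eq_zero (by omega)]
        refine le_trans ?_ (lpp_mono_right s t ξ (i + 1) (Nat.zero_le (j + 1)))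
        rw [lpp_zero_right, add_zero]
        exact Finset.sum_le_sum_of_subset (Finset.range_mono (by omega))
      · have h2 := ih j
        have h3 := ih (j + 1)
        rw [bulk_succ_succ, lpp_succ_succ]
        rw [min_eq_left (by omega)] at *
        simp only [fieldFrom, hik, decide_true, Bool.true_and] at *
        omega

variable (s t ξ) in
lemma bulk_le_lpp (i j : ℕ) : bulk ξ i j ≤ lpp s t ξ i j := by
  have h : fieldFrom ξ 0 = ξ := by funext a b; simp [fieldFrom]
  simpa [h] using sum_add_bulk_fieldFrom_le s t ξ 0 i j

variable (s ξ) in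
/-- The last passage value of paths from the horizontal axis leaving at `k`. -/
def exitValue (N k : ℕ) : ℕ :=
  ∑ l ∈ Finset.range k, (s l).toNat + bulk (fieldFrom ξ k) N N

variable (s t ξ) in
/-- An optimal path collects sources or sinks up to some point and then stays in the bulk. -/
lemma exists_lpp_le (i j : ℕ) :
    (∃ k ≤ i, lpp s t ξ i j ≤
      ∑ l ∈ Finset.range k, (s l).toNat + bulk (fieldFrom ξ k) i j) ∨
    (∃ k ≤ j, lpp s t ξ i j ≤
      ∑ l ∈ Finset.range k, (t l).toNat + bulk (fieldFrom (fun a b => ξ b a) k) j i) := by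
  induction i generalizing j with
  | zero => exact Or.inr ⟨j, le_rfl, by rw [lpp_zero_left]; omega⟩
  | succ i ih =>
    induction j with
    | zero => exact Or.inl ⟨i + 1, le_rfl, by rw [lpp_zero_right]; omega⟩
    | succ j ihj =>
      -- An optimal path is followed backwards along a term that attains the maximum.
      have hcases : lpp s t ξ (i + 1) (j + 1) = lpp s t ξ (i + 1) j ∨
          lpp s t ξ (i + 1) (j + 1) = lpp s t ξ i (j + 1) ∨
          lpp s t ξ (i + 1) (j + 1) = lpp s t ξ i j + (ξ i j).toNat := by
        rw [lpp_succ_succ]; omega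
      rcases hcases with h | h | h
      · rw [h]
        rcases ihj with ⟨k, hk, hle⟩ | ⟨k, hk, hle⟩
        · refine Or.inl ⟨k, hk, hle.trans (Nat.add_le_add_left ?_ _)⟩
          exact lpp_le_succ_right _ _ _ _ _
        · refine Or.inr ⟨k, by omega, hle.trans (Nat.add_le_add_left ?_ _)⟩
          exact lpp_le_succ_left _ _ _ _ _
      · rw [h]
        rcases ih (j + 1) with ⟨k, hk, hle⟩ | ⟨k, hk, hle⟩
        · refine Or.inl ⟨k, by omega, hle.trans (Nat.add_le_add_left ?_ _)⟩
          exact lpp_le_succ_left _ _ _ _ _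
        · refine Or.inr ⟨k, hk, hle.trans (Nat.add_le_add_left ?_ _)⟩
          exact lpp_le_succ_right _ _ _ _ _
      · rw [h]
        rcases ih j with ⟨k, hk, hle⟩ | ⟨k, hk, hle⟩
        · refine Or.inl ⟨k, by omega, ?_⟩
          rw [bulk_succ_succ]
          simp only [fieldFrom, hk, decide_true, Bool.true_and] at *
          omega
        · refine Or.inr ⟨k, by omega, ?_⟩
          rw [bulk_succ_succ]
          simp only [fieldFrom, hk, decide_true, Bool.true_and] at *
          omega

/-- Strict comparison of lattice points in both coordinates. -/
def StrictBoth (x y : ℕ × ℕ) : Prop := x.1 < y.1 ∧ x.2 < y.2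

/-- If the corner cell belongs to the chain, the other cells lie strictly below and to the left of
it. Otherwise the chain cannot meet both the last column and the last row, so one of the two can be
dropped. Together with `exists_chain_card_eq_bulk` this makes `bulk` the maximal size of a chain of
true cells. -/
lemma card_le_bulk (C : Finset (ℕ × ℕ)) (hC : IsChain StrictBoth (C : Set (ℕ × ℕ))) (i j : ℕ)
    (h : ∀ x ∈ C, ξ x.1 x.2 = true ∧ x.1 < i ∧ x.2 < j) : C.card ≤ bulk ξ i j := by
  induction i generalizing j C with
  | zero =>
    have : C = ∅ := Finset.eq_empty_of_forall_notMem fun x hx => by have := h x hx; omega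
    simp [this]
  | succ i ih =>
    induction j generalizing C with
    | zero =>
      have : C = ∅ := Finset.eq_empty_of_forall_notMem fun x hx => by have := h x hx; omega
      simp [this]
    | succ j ihj =>
      rw [bulk_succ_succ]
      by_cases hm : (i, j) ∈ C
      · have h1 := ih (C.erase (i, j)) (hC.mono (by simp)) j (fun x hx => by
          obtain ⟨hne, hx⟩ := Finset.mem_erase.1 hx
          have h2 := h x hx
          refine ⟨h2.1, ?_⟩
          rcases hC hx hm hne with h3 | h3 <;> simp only [StrictBoth] at h3 <;> omega)
        rw [Finset.card_erase_of_mem hm] at h1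
        have h2 := (h _ hm).1
        simp only at h2
        simp [h2]
        omega
      · by_cases hex : ∃ x ∈ C, x.1 = i
        · obtain ⟨x, hx, hxi⟩ := hex
          have h1 := ihj C hC (fun y hy => by
            have h2 := h y hy
            refine ⟨h2.1, h2.2.1, ?_⟩
            by_contra hlt
            have hyj : y.2 = j := by omega
            have hxj : x.2 ≠ j := fun h => hm (by rw [← hxi, ← h]; exact hx)
            have hxy : x ≠ y := fun h => hxj (h ▸ hyj)
            have := h x hx
            rcases hC hx hy hxy with h3 | h3 <;> simp only [StrictBoth] at h3 <;> omega)
          omega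
        · push Not at hex
          have h1 := ih C hC (j + 1) (fun y hy => by
            have h2 := h y hy
            have h3 := hex y hy
            exact ⟨h2.1, by omega, h2.2.2⟩)
          omega

variable (ξ) in
lemma exists_chain_card_eq_bulk (i j : ℕ) : ∃ C : Finset (ℕ × ℕ),
    IsChain StrictBoth (C : Set (ℕ × ℕ)) ∧
    (∀ x ∈ C, ξ x.1 x.2 = true ∧ x.1 < i ∧ x.2 < j) ∧ C.card = bulk ξ i j := by
  induction i generalizing j with
  | zero => exact ⟨∅, by simp, by simp, by simp [bulk_zero_left]⟩
  | succ i ih =>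
    induction j with
    | zero => exact ⟨∅, by simp, by simp, by simp [bulk_zero_right]⟩
    | succ j ihj =>
      have hcases : bulk ξ (i + 1) (j + 1) = bulk ξ (i + 1) j ∨
          bulk ξ (i + 1) (j + 1) = bulk ξ i (j + 1) ∨
          (ξ i j = true ∧ bulk ξ (i + 1) (j + 1) = bulk ξ i j + 1) := by
        have h1 : bulk ξ i j ≤ bulk ξ (i + 1) j := lpp_le_succ_left _ _ _ _ _
        rw [bulk_succ_succ]
        cases ξ i j <;> simp <;> omega
      rcases hcases with h | h | ⟨hξ, h⟩
      · obtain ⟨C, h1, h2, h3⟩ := ihj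
        exact ⟨C, h1, fun x hx => by have := h2 x hx; exact ⟨this.1, by omega, by omega⟩,
          by omega⟩
      · obtain ⟨C, h1, h2, h3⟩ := ih (j + 1)
        exact ⟨C, h1, fun x hx => by have := h2 x hx; exact ⟨this.1, by omega, by omega⟩,
          by omega⟩
      · obtain ⟨C, h1, h2, h3⟩ := ih j
        have hn : (i, j) ∉ C := fun hm => by have := h2 _ hm; simp at this
        refine ⟨insert (i, j) C, ?_, ?_, by rw [Finset.card_insert_of_notMem hn]; omega⟩
        · rw [Finset.coe_insert]
          exact h1.insert fun y hy _ => Or.inr (h2 y hy).2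
        · intro x hx
          rcases Finset.mem_insert.1 hx with rfl | hx
          · exact ⟨hξ, by simp, by simp⟩
          · have := h2 x hx; exact ⟨this.1, by omega, by omega⟩

end LastPassage

/-! ### Independent Bernoulli fields, Chebyshev bounds, and the invariant local rule -/

section BernoulliField

variable {ι : Type*} [Fintype ι]

/-- The law of independent Bernoulli variables with parameters `w i`. -/
noncomputable def bernoulliField (w : ι → unitInterval) : Measure (ι → Bool) :=
  Measure.pi fun i => bernoulliMeasure true false (w i)

instance (w : ι → unitInterval) : IsProbabilityMeasure (bernoulliField w) := by
  unfold bernoulliField; infer_instance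

lemma integral_bernoulliMeasure_bool (p : unitInterval) (f : Bool → ℝ) :
    ∫ v, f v ∂(bernoulliMeasure true false p) = p * f true + (1 - p) * f false := by
  rw [integral_fintype .of_finite]
  simp [bernoulliMeasure_real_apply]

lemma integral_sum_bernoulliField (w : ι → unitInterval) (A : Finset ι) :
    ∫ x, ∑ i ∈ A, ((x i).toNat : ℝ) ∂(bernoulliField w) = ∑ i ∈ A, (w i : ℝ) := by
  rw [integral_finsetSum _ fun i _ => .of_finite]
  refine Finset.sum_congr rfl fun i _ => ?_
  rw [bernoulliField, integral_comp_eval (X := fun _ => Bool) (f := fun v : Bool => (v.toNat : ℝ))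
    (measurable_of_finite _).aestronglyMeasurable, integral_bernoulliMeasure_bool]
  simp

lemma variance_sum_bernoulliField_le (w : ι → unitInterval) (A : Finset ι) :
    Var[fun x => ∑ i ∈ A, ((x i).toNat : ℝ); bernoulliField w] ≤ ∑ i ∈ A, (w i : ℝ) := by
  classical
  -- The variance formula sums over all coordinates, so those outside `A` contribute the zero
  -- function.
  have h := variance_sum_pi (μ := fun i => bernoulliMeasure true false (w i))
    (X := fun i v => if i ∈ A then ((v : Bool).toNat : ℝ) else 0)
    (fun i => MemLp.of_discrete)
  have h1 : (∑ i, fun ω : ι → Bool => if i ∈ A then ((ω i).toNat : ℝ) else 0) =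
      fun x => ∑ i ∈ A, ((x i).toNat : ℝ) := by
    ext x
    simp [Finset.sum_ite_mem]
  rw [h1] at h
  rw [bernoulliField, h, ← Finset.sum_filter_add_sum_filter_not Finset.univ (· ∈ A),
    Finset.filter_mem_eq_inter, Finset.univ_inter]
  have h2 : ∑ i ∈ Finset.univ.filter (· ∉ A),
      Var[fun v : Bool => if i ∈ A then (v.toNat : ℝ) else 0;
        bernoulliMeasure true false (w i)] = 0 := by
    refine Finset.sum_eq_zero fun i hi => ?_
    simp only [Finset.mem_filter] at hi
    simp only [hi.2, if_false]
    exact variance_zero _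
  rw [h2, add_zero]
  refine Finset.sum_le_sum fun i hi => ?_
  simp only [hi, if_true]
  refine (variance_le_expectation_sq (measurable_of_finite _).aestronglyMeasurable).trans ?_
  simp [integral_bernoulliMeasure_bool]

lemma measureReal_sum_sub_ge_le (w : ι → unitInterval) (A : Finset ι) {c : ℝ} (hc : 0 < c) :
    (bernoulliField w).real {x | c ≤ |∑ i ∈ A, ((x i).toNat : ℝ) - ∑ i ∈ A, (w i : ℝ)|} ≤
      (∑ i ∈ A, (w i : ℝ)) / c ^ 2 := by
  have h := meas_ge_le_variance_div_sq (μ := bernoulliField w)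
    (X := fun x => ∑ i ∈ A, ((x i).toNat : ℝ)) MemLp.of_discrete hc
  rw [integral_sum_bernoulliField] at h
  have h0 : 0 ≤ ∑ i ∈ A, (w i : ℝ) := Finset.sum_nonneg fun i _ => (w i).2.1
  refine ENNReal.toReal_le_of_le_ofReal (by positivity) (h.trans (ENNReal.ofReal_le_ofReal ?_))
  gcongr
  exact variance_sum_bernoulliField_le w A

variable [DecidableEq ι]

lemma map_update_bernoulliField (w : ι → unitInterval) (a : ι) :
    ((bernoulliField w).prod (bernoulliMeasure true false (w a))).map
      (fun p => Function.update p.1 a p.2) = bernoulliField w := by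
  symm
  refine Measure.pi_eq fun s hs => ?_
  rw [Measure.map_apply (measurable_of_finite _) (MeasurableSet.of_discrete)]
  have : (fun p : (ι → Bool) × Bool => Function.update p.1 a p.2) ⁻¹' Set.univ.pi s =
      (Set.univ.pi (Function.update s a Set.univ)) ×ˢ s a := by
    ext ⟨x, v⟩
    simp only [Set.mem_preimage, Set.mem_univ_pi, Set.mem_prod]
    constructor
    · intro h
      refine ⟨fun i => ?_, by simpa using h a⟩
      by_cases hi : i = a
      · subst hi; simp
      · simpa [hi] using h i
    · rintro ⟨h, hv⟩ i
      by_cases hi : i = a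
      · subst hi; simpa using hv
      · simpa [hi] using h i
  rw [this, Measure.prod_prod, bernoulliField, Measure.pi_pi,
    ← Finset.prod_erase_mul _ _ (Finset.mem_univ a),
    ← Finset.prod_erase_mul Finset.univ (fun i => bernoulliMeasure true false (w i) (s i))
      (Finset.mem_univ a)]
  simp only [Function.update_self, measure_univ, mul_one]
  congr 1
  refine Finset.prod_congr rfl fun i hi => ?_
  rw [Function.update_of_ne (Finset.ne_of_mem_erase hi)]

/-- Averaging explicitly over one coordinate reduces an equality of integrals to a pointwise
identity in finitely many Boolean values. -/
lemma integral_resample (w : ι → unitInterval) (a : ι) (F : (ι → Bool) → ℝ) :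
    ∫ x, F x ∂(bernoulliField w) =
      ∫ x, ((w a : ℝ) * F (Function.update x a true) +
        (1 - w a) * F (Function.update x a false)) ∂(bernoulliField w) := by
  conv_lhs => rw [← map_update_bernoulliField w a]
  rw [integral_map (measurable_of_finite _).aemeasurable
    (measurable_of_finite _).aestronglyMeasurable, integral_prod _ .of_finite]
  simp_rw [integral_bernoulliMeasure_bool]

/-- The local rule by which horizontal and vertical increments of last passage values evolve. -/
def localStep (a b c : ι) (x : ι → Bool) : ι → Bool :=
  Function.update (Function.update x a (!x b && (x a || x c))) b (!x a && (x b || x c))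

/-- The one-cell Burke property. The pairs (1,0) and (0,1) are fixed by the rule; (1,1) is sent to
(0,0); (0,0) becomes (1,1) if the cell is true and stays otherwise. Invariance thus only requires
that the mass leaving (1,1) equal the mass entering it, which is `hw`. The cell value is correlated
with the new pair, so `F` must ignore it. -/
lemma integral_localStep {w : ι → unitInterval} {a b c : ι} (hab : a ≠ b) (hac : a ≠ c)
    (hbc : b ≠ c) (hw : (w a : ℝ) * w b = w c * (1 - w a) * (1 - w b))
    (F : (ι → Bool) → ℝ) (hF : ∀ x v, F (Function.update x c v) = F x) :
    ∫ x, F (localStep a b c x) ∂(bernoulliField w) = ∫ x, F x ∂(bernoulliField w) := by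
  rw [integral_resample w c, integral_resample w b, integral_resample w a]
  conv_rhs => rw [integral_resample w b, integral_resample w a]
  congr 1
  ext x
  have key : ∀ u v z, F (localStep a b c (Function.update (Function.update (Function.update x a u)
      b v) c z)) = F (Function.update (Function.update x a (!v && (u || z))) b
        (!u && (v || z))) := by
    intro u v z
    rw [← hF _ z]
    conv_rhs => rw [← hF _ z]
    congr 1
    ext i
    by_cases h1 : i = c
    · subst h1; simp
    · by_cases h2 : i = b
      · subst h2; simp [localStep, h1, hab, hac]
      · by_cases h3 : i = a
        · subst h3; simp [localStep, h1, h2, hbc]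
        · simp [localStep, h1, h2, h3]
  simp only [key]
  simp only [Bool.not_true, Bool.not_false, Bool.or_true,
    Bool.or_false, Bool.and_true, Bool.and_false]
  linear_combination (F (Function.update (Function.update x a true) b true) -
    F (Function.update (Function.update x a false) b false)) * (-hw)

end BernoulliField

/-! ### Stationarity of the increments across the grid -/

section Stationarity

variable {N : ℕ}

/-- The cells of an `N × N` grid, its `N` sources and its `N` sinks. -/
abbrev Site (N : ℕ) := (Fin N × Fin N) ⊕ (Fin N ⊕ Fin N)

/-- The sources of a configuration. -/
def sourceOf (x : Site N → Bool) (i : ℕ) : Bool :=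
  if h : i < N then x (.inr (.inl ⟨i, h⟩)) else false

/-- The sinks of a configuration. -/
def sinkOf (x : Site N → Bool) (j : ℕ) : Bool :=
  if h : j < N then x (.inr (.inr ⟨j, h⟩)) else false

/-- The field on the quadrant which vanishes outside of the grid. -/
def extendField (x : Fin N × Fin N → Bool) (i j : ℕ) : Bool :=
  if h : i < N ∧ j < N then x (⟨i, h.1⟩, ⟨j, h.2⟩) else false

/-- The field of a configuration. -/
def fieldOf (x : Site N → Bool) : ℕ → ℕ → Bool := extendField fun c => x (.inl c)

/-- The cells of the grid which are already used when the first `j` rows and the first `i` cells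
of the next row are used. -/
def Used (i j : ℕ) (c : Fin N × Fin N) : Prop := c.2.1 < j ∨ c.2.1 = j ∧ c.1.1 < i

/-- The configuration in which the sources and sinks are replaced by the increments of the last
passage values along the boundary of the region of used cells. -/
def stage (i j : ℕ) (x : Site N → Bool) : Site N → Bool
  | .inl c => x (.inl c)
  | .inr (.inl k) => lppX (sourceOf x) (sinkOf x) (fieldOf x) k (if k.1 < i then j + 1 else j)
  | .inr (.inr l) => lppY (sourceOf x) (sinkOf x) (fieldOf x)
      (if l.1 < j then N else if l.1 = j then i else 0) l

lemma stage_zero_zero (x : Site N → Bool) : stage 0 0 x = x := by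
  ext (c | k | l)
  · rfl
  · simp [stage, lppX_zero, sourceOf]
  · simp [stage, lppY_zero, sinkOf]

lemma stage_row_end (j : ℕ) (x : Site N → Bool) : stage N j x = stage 0 (j + 1) x := by
  ext (c | k | l)
  · rfl
  · simp [stage]
  · have : (if l.1 < j then N else if l.1 = j then N else 0) =
        (if l.1 < j + 1 then N else if l.1 = j + 1 then 0 else 0) := by
      split_ifs <;> omega
    simp only [stage, this]

/-- Using one more cell moves the boundary path across a single unit square, so only one horizontal
and one vertical increment change. -/
lemma stage_succ (i j : Fin N) (x : Site N → Bool) : stage (i + 1) j x =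
    localStep (.inr (.inl i)) (.inr (.inr j)) (.inl (i, j)) (stage i j x) := by
  have hξ : fieldOf x i j = x (.inl (i, j)) := by simp [fieldOf, extendField]
  ext (c | k | l)
  · simp [stage, localStep]
  · by_cases hk : k = i
    · subst hk
      simp [stage, localStep, lppX_succ, hξ]
    · have hk' : k.1 ≠ i.1 := fun h => hk (Fin.ext h)
      have : (if k.1 < i.1 + 1 then j.1 + 1 else j.1) = if k.1 < i.1 then j.1 + 1 else j.1 := by
        split_ifs <;> omega
      simp only [stage, this]
      simp [localStep, stage, hk]
  · by_cases hl : l = j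
    · subst hl
      simp [stage, localStep, lppY_succ, hξ]
    · have hl' : l.1 ≠ j.1 := fun h => hl (Fin.ext h)
      simp [stage, localStep, hl, hl']

/-- The law of the increments along the boundary of the used region is the initial law. -/
def StageInvariant (w : Site N → unitInterval) (i j : ℕ) : Prop :=
  ∀ F : (Site N → Bool) → ℝ,
    (∀ x c v, Used i j c → F (Function.update x (.inl c) v) = F x) →
    ∫ x, F (stage i j x) ∂(bernoulliField w) = ∫ x, F x ∂(bernoulliField w)

/-- The relation between the parameters of the field, the sources and the sinks under which the
law of the increments of last passage values is stationary. -/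
def BalancedWeights (w : Site N → unitInterval) : Prop :=
  ∀ i j : Fin N, (w (.inr (.inl i)) : ℝ) * w (.inr (.inr j)) =
    w (.inl (i, j)) * (1 - w (.inr (.inl i))) * (1 - w (.inr (.inr j)))

lemma BalancedWeights.stageInvariant_succ {w : Site N → unitInterval} (hw : BalancedWeights w)
    (i j : Fin N)
    (h : StageInvariant w i j) : StageInvariant w (i + 1) j := by
  intro F hF
  simp_rw [stage_succ]
  -- The induction hypothesis is applied to `F` after the local rule. This function reads the cell
  -- `(i, j)`, which is still unused at the earlier stage, whereas `F` itself ignores it, as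
  -- `integral_localStep` requires.
  rw [h fun x => F (localStep (.inr (.inl i)) (.inr (.inr j)) (.inl (i, j)) x)]
  · exact integral_localStep (by simp) (by simp) (by simp) (hw i j) F
      fun x v => hF x (i, j) v (by simp [Used])
  · intro x c v hc
    have hne : c ≠ (i, j) := by rintro rfl; simp [Used] at hc
    have hu : Used (i + 1) j c := by unfold Used at *; omega
    rw [← hF (localStep _ _ _ x) c v hu]
    congr 1
    ext (d | k | l)
    · by_cases hd : d = c
      · subst hd; simp [localStep]
      · simp [localStep, hd]
    · by_cases hk : k = i
      · subst hk; simp [localStep, hne.symm]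
      · simp [localStep, hk]
    · by_cases hl : l = j
      · subst hl; simp [localStep, hne.symm]
      · simp [localStep, hl]

lemma BalancedWeights.stageInvariant {w : Site N → unitInterval} (hw : BalancedWeights w) (j : ℕ)
    (hj : j ≤ N) :
    StageInvariant w 0 j := by
  induction j with
  | zero => intro F _; simp [stage_zero_zero]
  | succ j ih =>
    have hrow : ∀ i ≤ N, StageInvariant w i j := by
      intro i hi
      induction i with
      | zero => exact ih (by omega)
      | succ i ihi => exact hw.stageInvariant_succ ⟨i, hi⟩ ⟨j, hj⟩ (ihi (by omega))
    intro F hF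
    simp_rw [← stage_row_end]
    refine hrow N le_rfl F fun x c v hc => hF x c v ?_
    unfold Used at *; omega

/-- The exits on the right have the law of the sinks. -/
lemma BalancedWeights.integral_exits {w : Site N → unitInterval} (hw : BalancedWeights w)
    (f : (Fin N → Bool) → ℝ) :
    ∫ x, f (fun l => lppY (sourceOf x) (sinkOf x) (fieldOf x) N l) ∂(bernoulliField w) =
      ∫ x, f (fun l => x (.inr (.inr l))) ∂(bernoulliField w) := by
  rw [← hw.stageInvariant N le_rfl fun x => f (fun l => x (.inr (.inr l)))]
  · simp [stage]
  · intro x c v _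
    simp

lemma BalancedWeights.measureReal_exits {w : Site N → unitInterval} (hw : BalancedWeights w)
    (A : Set (Fin N → Bool)) :
    (bernoulliField w).real {x | (fun l : Fin N =>
        lppY (sourceOf x) (sinkOf x) (fieldOf x) N l) ∈ A} =
      (bernoulliField w).real {x | (fun l => x (.inr (.inr l))) ∈ A} := by
  have h := hw.integral_exits (A.indicator (1 : (Fin N → Bool) → ℝ))
  have h1 : ∀ g : (Site N → Bool) → (Fin N → Bool),
      ∫ x, A.indicator (1 : (Fin N → Bool) → ℝ) (g x) ∂(bernoulliField w) =
        (bernoulliField w).real {x | g x ∈ A} := by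
    intro g
    rw [← integral_indicator_one (MeasurableSet.of_discrete)]
    rfl
  rwa [h1, h1] at h

end Stationarity

/-! ### Reindexing and monotone coupling of Bernoulli fields -/

section Transfer

variable {ι κ : Type*} [Fintype ι] [Fintype κ]

/-- Covers three uses: restriction of a configuration to the cells, reflection of the grid, and
permutation of rows. -/
lemma map_comp_bernoulliField (w : ι → unitInterval) {e : κ → ι} (he : e.Injective) :
    (bernoulliField w).map (fun x => x ∘ e) = bernoulliField (w ∘ e) := by
  have h := (iIndepFun_pi (μ := fun i => bernoulliMeasure true false (w i))
    (X := fun _ v => v) (fun _ => measurable_id.aemeasurable)).precomp he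
  rw [iIndepFun_iff_map_fun_eq_pi_map fun _ => (measurable_of_finite _).aemeasurable] at h
  refine h.trans ?_
  unfold bernoulliField
  congr 1
  ext1 k
  exact (measurePreserving_eval (fun i => bernoulliMeasure true false (w i)) (e k)).map_eq

lemma bernoulliField_real_comp (w : ι → unitInterval) {e : κ → ι} (he : e.Injective)
    (A : Set (κ → Bool)) :
    (bernoulliField w).real {x | x ∘ e ∈ A} = (bernoulliField (w ∘ e)).real A := by
  rw [← map_comp_bernoulliField w he, map_measureReal_apply (measurable_of_finite _) .of_discrete]
  rfl

lemma bernoulliMeasure_bool_ext {p : unitInterval} {m : Measure Bool} [IsProbabilityMeasure m]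
    (h : m.real {true} = p) : m = bernoulliMeasure true false p := by
  have h1 : m.real {false} = 1 - p := by
    have := probReal_compl_eq_one_sub (μ := m) (s := {true}) .of_discrete
    rw [← h, ← this]
    congr 1
    ext v; cases v <;> simp
  refine Measure.ext_of_singleton fun v => ?_
  rw [← ENNReal.toReal_eq_toReal_iff' (measure_ne_top _ _) (measure_ne_top _ _)]
  change m.real {v} = (bernoulliMeasure true false p).real {v}
  cases v <;> simp [h, h1]

lemma map_and_bernoulliMeasure {a b c : unitInterval} (h : (a : ℝ) * b = c) :
    ((bernoulliMeasure true false a).prod (bernoulliMeasure true false b)).map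
      (fun v => v.1 && v.2) = bernoulliMeasure true false c := by
  have : IsProbabilityMeasure
      (((bernoulliMeasure true false a).prod (bernoulliMeasure true false b)).map
        (fun v : Bool × Bool => v.1 && v.2)) :=
    Measure.isProbabilityMeasure_map (measurable_of_finite _).aemeasurable
  refine bernoulliMeasure_bool_ext ?_
  rw [map_measureReal_apply (measurable_of_finite _) .of_discrete]
  have : (fun v : Bool × Bool => v.1 && v.2) ⁻¹' {true} = {true} ×ˢ {true} := by
    ext ⟨u, v⟩; simp
  rw [this, measureReal_prod_prod]
  simp [h]

/-- The monotone coupling of two Bernoulli variables. -/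
lemma exists_bernoulli_coupling (a b : unitInterval) :
    ∃ m : Measure (Bool × Bool), IsProbabilityMeasure m ∧
      m.map Prod.fst = bernoulliMeasure true false a ∧
      m.map Prod.snd = bernoulliMeasure true false b ∧
      (a ≤ b → ∀ᵐ v ∂m, v.1 = true → v.2 = true) ∧
      (b ≤ a → ∀ᵐ v ∂m, v.2 = true → v.1 = true) := by
  have hlt : ∀ a b : unitInterval, a < b → ∃ m : Measure (Bool × Bool), IsProbabilityMeasure m ∧
      m.map Prod.fst = bernoulliMeasure true false a ∧
      m.map Prod.snd = bernoulliMeasure true false b ∧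
      ∀ᵐ v ∂m, v.1 = true → v.2 = true := by
    intro a b hab
    have hb : (0 : ℝ) < b := lt_of_le_of_lt a.2.1 hab
    have hab' : (a : ℝ) ≤ b := hab.le
    -- Thinning: the smaller variable is the larger one multiplied by an independent Bernoulli(a/b).
    let c : unitInterval := ⟨a / b, div_nonneg a.2.1 b.2.1, div_le_one_of_le₀ hab' b.2.1⟩
    have hc : (b : ℝ) * c = a := mul_div_cancel₀ _ hb.ne'
    refine ⟨((bernoulliMeasure true false b).prod (bernoulliMeasure true false c)).map
      (fun v => (v.1 && v.2, v.1)),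
      Measure.isProbabilityMeasure_map (measurable_of_finite _).aemeasurable, ?_, ?_, ?_⟩
    · rw [Measure.map_map (measurable_of_finite _) (measurable_of_finite _)]
      exact map_and_bernoulliMeasure hc
    · rw [Measure.map_map (measurable_of_finite _) (measurable_of_finite _)]
      exact Measure.fst_prod
    · rw [ae_map_iff (measurable_of_finite _).aemeasurable .of_discrete]
      exact ae_of_all _ fun v => by simp +contextual
  rcases lt_trichotomy a b with h | rfl | h
  · obtain ⟨m, h0, h1, h2, h3⟩ := hlt a b h
    exact ⟨m, h0, h1, h2, fun _ => h3, fun h' => absurd h (not_lt.2 h')⟩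
  -- For equal parameters both implications are required, so the two variables are taken identical.
  · refine ⟨(bernoulliMeasure true false a).map (fun v => (v, v)),
      Measure.isProbabilityMeasure_map (measurable_of_finite _).aemeasurable, ?_, ?_, ?_, ?_⟩
    · rw [Measure.map_map (measurable_of_finite _) (measurable_of_finite _)]
      exact Measure.map_id
    · rw [Measure.map_map (measurable_of_finite _) (measurable_of_finite _)]
      exact Measure.map_id
    all_goals
      rw [ae_map_iff (measurable_of_finite _).aemeasurable .of_discrete]
      exact fun _ => ae_of_all _ fun v => id
  · obtain ⟨m, h0, h1, h2, h3⟩ := hlt b a h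
    refine ⟨m.map Prod.swap,
      Measure.isProbabilityMeasure_map (measurable_of_finite _).aemeasurable, ?_, ?_,
      fun h' => absurd h (not_lt.2 h'), fun _ => ?_⟩
    · rwa [Measure.map_map (measurable_of_finite _) (measurable_of_finite _)]
    · rwa [Measure.map_map (measurable_of_finite _) (measurable_of_finite _)]
    · rw [ae_map_iff (measurable_of_finite _).aemeasurable .of_discrete]
      exact h3

/-- Coordinatewise monotone coupling of two Bernoulli fields. -/
lemma exists_bernoulliField_coupling (u v : ι → unitInterval) :
    ∃ m : Measure (ι → Bool × Bool), IsProbabilityMeasure m ∧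
      m.map (fun x i => (x i).1) = bernoulliField u ∧
      m.map (fun x i => (x i).2) = bernoulliField v ∧
      ∀ᵐ x ∂m, ∀ i, (u i ≤ v i → (x i).1 = true → (x i).2 = true) ∧
        (v i ≤ u i → (x i).2 = true → (x i).1 = true) := by
  choose m h0 h1 h2 h3 h4 using fun i => exists_bernoulli_coupling (u i) (v i)
  refine ⟨Measure.pi m, inferInstance, ?_, ?_, ?_⟩
  · rw [Measure.pi_map_pi (f := fun _ => Prod.fst) fun i => measurable_fst.aemeasurable]
    simp only [h1]
    rfl
  · rw [Measure.pi_map_pi (f := fun _ => Prod.snd) fun i => measurable_snd.aemeasurable]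
    simp only [h2]
    rfl
  · rw [ae_all_iff]
    intro i
    refine (Measure.quasiMeasurePreserving_eval m i).ae
      (p := fun y : Bool × Bool => (u i ≤ v i → y.1 = true → y.2 = true) ∧
        (v i ≤ u i → y.2 = true → y.1 = true)) ?_
    by_cases ha : u i ≤ v i <;> by_cases hb : v i ≤ u i
    · filter_upwards [h3 i ha, h4 i hb] with y hy hy' using ⟨fun _ => hy, fun _ => hy'⟩
    · filter_upwards [h3 i ha] with y hy using ⟨fun _ => hy, fun h => absurd h hb⟩
    · filter_upwards [h4 i hb] with y hy using ⟨fun h => absurd h ha, fun _ => hy⟩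
    · exact absurd (le_total (u i) (v i)) (by tauto)

end Transfer

/-! ### Concentration of the stationary passage value, and exit points -/

section StationaryModel

variable {N : ℕ}

/-- The first `K` sources. -/
def sourceSites {K : ℕ} (h : K ≤ N) : Finset (Site N) :=
  (Finset.univ : Finset (Fin K)).map
    ((Fin.castLEEmb h).trans (Function.Embedding.inl.trans Function.Embedding.inr))

/-- The sinks. -/
def sinkSites (N : ℕ) : Finset (Site N) :=
  (Finset.univ : Finset (Fin N)).map (Function.Embedding.inr.trans Function.Embedding.inr)

/-- The number of sources among the first `K`. -/
def sourceCount (K : ℕ) (x : Site N → Bool) : ℕ :=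
  ∑ k ∈ Finset.range K, (sourceOf x k).toNat

lemma sourceCount_eq {K : ℕ} (h : K ≤ N) (x : Site N → Bool) :
    (sourceCount K x : ℝ) = ∑ i ∈ sourceSites h, ((x i).toNat : ℝ) := by
  rw [sourceCount, sourceSites, Finset.sum_map, Finset.sum_range]
  push_cast
  refine Finset.sum_congr rfl fun k _ => ?_
  have : k.1 < N := by omega
  simp [sourceOf, this]
  rfl

/-- The parameters of the field, the sources and the sinks. -/
def siteWeight (N : ℕ) (p a b : unitInterval) : Site N → unitInterval
  | .inl _ => p
  | .inr (.inl _) => a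
  | .inr (.inr _) => b

lemma sum_sourceSites {K : ℕ} (h : K ≤ N) (p a b : unitInterval) :
    ∑ i ∈ sourceSites h, (siteWeight N p a b i : ℝ) = K * a := by
  simp [sourceSites, siteWeight]

lemma sum_sinkSites (p a b : unitInterval) :
    ∑ i ∈ sinkSites N, (siteWeight N p a b i : ℝ) = N * b := by
  simp [sinkSites, siteWeight]

/-- The last passage value to the corner of the grid. -/
def lastPassage (x : Site N → Bool) : ℕ := lpp (sourceOf x) (sinkOf x) (fieldOf x) N N

/-- The number of exits on the right. -/
def exitCount (x : Site N → Bool) : ℕ :=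
  ∑ l : Fin N, (lppY (sourceOf x) (sinkOf x) (fieldOf x) N l).toNat

lemma lastPassage_eq (x : Site N → Bool) : lastPassage x = sourceCount N x + exitCount x := by
  rw [lastPassage, lpp_eq_sum_add_sum, sourceCount, exitCount, Finset.sum_range
    (fun k => (lppY (sourceOf x) (sinkOf x) (fieldOf x) N k).toNat)]

lemma measureReal_sourceCount_ge_le {K : ℕ} (h : K ≤ N) (p a b : unitInterval) {c : ℝ}
    (hc : 0 < c) : (bernoulliField (siteWeight N p a b)).real
      {x | c ≤ |(sourceCount K x : ℝ) - K * a|} ≤ K * a / c ^ 2 := by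
  have := measureReal_sum_sub_ge_le (siteWeight N p a b) (sourceSites h) hc
  rw [sum_sourceSites] at this
  simpa only [sourceCount_eq h] using this

lemma measureReal_exitCount_ge_le {p a b : unitInterval}
    (hw : BalancedWeights (siteWeight N p a b)) {c : ℝ} (hc : 0 < c) :
    (bernoulliField (siteWeight N p a b)).real {x | c ≤ |(exitCount x : ℝ) - N * b|} ≤
      N * b / c ^ 2 := by
  have h1 := measureReal_sum_sub_ge_le (siteWeight N p a b) (sinkSites N) hc
  have h2 := hw.measureReal_exits {y | c ≤ |∑ l, ((y l).toNat : ℝ) - N * b|}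
  simp only [Set.mem_ofPred_eq] at h2
  simp only [exitCount, Nat.cast_sum]
  rw [h2]
  rw [sum_sinkSites] at h1
  simpa [sinkSites] using h1

/-- Sources and exits are not independent of each other, but each sum concentrates; a union bound
with deviation `c / 2` for each suffices. -/
lemma measureReal_lastPassage_ge_le {p a b : unitInterval}
    (hw : BalancedWeights (siteWeight N p a b)) {c : ℝ} (hc : 0 < c) :
    (bernoulliField (siteWeight N p a b)).real
      {x | c ≤ |(lastPassage x : ℝ) - (N * a + N * b)|} ≤ 4 * (N * a + N * b) / c ^ 2 := by
  have h1 := measureReal_sourceCount_ge_le le_rfl p a b (N := N) (half_pos hc)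
  have h2 := measureReal_exitCount_ge_le hw (half_pos hc)
  calc _ ≤ (bernoulliField (siteWeight N p a b)).real
        ({x | c / 2 ≤ |(sourceCount N x : ℝ) - N * a|} ∪
          {x | c / 2 ≤ |(exitCount x : ℝ) - N * b|}) := by
        refine measureReal_mono fun x hx => ?_
        by_contra hcon
        simp only [Set.mem_union, Set.mem_ofPred_eq, not_or, not_le] at hcon hx
        rw [lastPassage_eq] at hx
        push_cast at hx
        have := abs_add_le ((sourceCount N x : ℝ) - N * a) ((exitCount x : ℝ) - N * b)
        rw [show (sourceCount N x : ℝ) + exitCount x - (N * a + N * b) =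
          (sourceCount N x : ℝ) - N * a + ((exitCount x : ℝ) - N * b) by ring] at hx
        linarith
    _ ≤ _ := measureReal_union_le _ _
    _ ≤ N * a / (c / 2) ^ 2 + N * b / (c / 2) ^ 2 := add_le_add h1 h2
    _ = _ := by field_simp; ring

lemma measureReal_lastPassage_ge {p a b : unitInterval}
    (hw : BalancedWeights (siteWeight N p a b)) {c B : ℝ} (hc : 0 < c)
    (hB : N * (a : ℝ) + N * b ≤ B) : (bernoulliField (siteWeight N p a b)).real
      {x | N * (a : ℝ) + N * b + c ≤ lastPassage x} ≤ 4 * B / c ^ 2 := by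
  refine (measureReal_mono fun x hx => ?_).trans
    ((measureReal_lastPassage_ge_le hw hc).trans (by gcongr))
  rw [Set.mem_ofPred_eq] at hx ⊢
  exact (le_sub_iff_add_le'.2 hx).trans (le_abs_self _)

lemma measureReal_lastPassage_le {p a b : unitInterval}
    (hw : BalancedWeights (siteWeight N p a b)) {c B : ℝ} (hc : 0 < c)
    (hB : N * (a : ℝ) + N * b ≤ B) : (bernoulliField (siteWeight N p a b)).real
      {x | (lastPassage x : ℝ) ≤ N * a + N * b - c} ≤ 4 * B / c ^ 2 := by
  refine (measureReal_mono fun x hx => ?_).trans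
    ((measureReal_lastPassage_ge_le hw hc).trans (by gcongr))
  rw [Set.mem_ofPred_eq] at hx ⊢
  exact (le_sub_comm.1 hx).trans ((neg_sub _ _).symm.le.trans (neg_le_abs _))

lemma measureReal_sourceCount_ge {K : ℕ} (h : K ≤ N) (p a b : unitInterval) {c B : ℝ}
    (hc : 0 < c) (hB : K * (a : ℝ) ≤ B) : (bernoulliField (siteWeight N p a b)).real
      {x | K * (a : ℝ) + c ≤ sourceCount K x} ≤ B / c ^ 2 := by
  refine (measureReal_mono fun x hx => ?_).trans
    ((measureReal_sourceCount_ge_le h p a b hc).trans (by gcongr))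
  rw [Set.mem_ofPred_eq] at hx ⊢
  exact (le_sub_iff_add_le'.2 hx).trans (le_abs_self _)

lemma measureReal_sourceCount_le {K : ℕ} (h : K ≤ N) (p a b : unitInterval) {c B : ℝ}
    (hc : 0 < c) (hB : K * (a : ℝ) ≤ B) : (bernoulliField (siteWeight N p a b)).real
      {x | (sourceCount K x : ℝ) ≤ K * a - c} ≤ B / c ^ 2 := by
  refine (measureReal_mono fun x hx => ?_).trans
    ((measureReal_sourceCount_ge_le h p a b hc).trans (by gcongr))
  rw [Set.mem_ofPred_eq] at hx ⊢
  exact (le_sub_comm.1 hx).trans ((neg_sub _ _).symm.le.trans (neg_le_abs _))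

lemma integral_lastPassage {p a b : unitInterval}
    (hw : BalancedWeights (siteWeight N p a b)) :
    ∫ x, (lastPassage x : ℝ) ∂(bernoulliField (siteWeight N p a b)) = N * a + N * b := by
  simp_rw [lastPassage_eq, Nat.cast_add]
  rw [integral_add .of_finite .of_finite]
  congr 1
  · simp_rw [sourceCount_eq le_rfl]
    rw [integral_sum_bernoulliField, sum_sourceSites]
  · have h := hw.integral_exits fun y => ∑ l, ((y l).toNat : ℝ)
    simp only [exitCount, Nat.cast_sum]
    rw [h, ← sum_sinkSites p a b, ← integral_sum_bernoulliField]
    simp [sinkSites]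

/-- The probability with given odds. -/
noncomputable def oddsProb {q : ℝ} (hq : 0 ≤ q) : unitInterval :=
  ⟨q / (1 + q), by positivity, div_le_one_of_le₀ (by linarith) (by positivity)⟩

/-- Dividing the balance relation by (1 - a)(1 - b) turns it into a product of odds, so balanced
models form a one-parameter family for each p. -/
lemma balancedWeights_oddsProb {p : unitInterval} {a b : ℝ} (ha : 0 ≤ a) (hb : 0 ≤ b)
    (h : a * b = p) : BalancedWeights (siteWeight N p (oddsProb ha) (oddsProb hb)) := by
  intro i j
  simp only [siteWeight, oddsProb]
  rw [← h]
  field_simp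
  ring

/-- Whether an optimal path leaves the horizontal axis at `K` or later. -/
def ExitsFrom (K : ℕ) (x : Site N → Bool) : Prop :=
  ∃ k, K ≤ k ∧ k ≤ N ∧ lastPassage x ≤ exitValue (sourceOf x) (fieldOf x) N k

/-- The reflection of the grid at the diagonal. -/
def reflect : Site N → Site N
  | .inl c => .inl c.swap
  | .inr (.inl i) => .inr (.inr i)
  | .inr (.inr i) => .inr (.inl i)

lemma reflect_injective : (reflect (N := N)).Injective := by
  have : Function.Involutive (reflect (N := N)) := by rintro (c | i | i) <;> simp [reflect]
  exact this.injective

lemma sourceOf_comp_reflect (x : Site N → Bool) : sourceOf (x ∘ reflect) = sinkOf x := rfl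

lemma sinkOf_comp_reflect (x : Site N → Bool) : sinkOf (x ∘ reflect) = sourceOf x := rfl

lemma fieldOf_comp_reflect (x : Site N → Bool) :
    fieldOf (x ∘ reflect) = fun i j => fieldOf x j i := by
  ext i j
  simp only [fieldOf, extendField]
  by_cases h1 : i < N <;> by_cases h2 : j < N <;> simp [h1, h2, reflect]

lemma lastPassage_comp_reflect (x : Site N → Bool) : lastPassage (x ∘ reflect) = lastPassage x := by
  rw [lastPassage, sourceOf_comp_reflect, sinkOf_comp_reflect, fieldOf_comp_reflect, lpp_swap]
  rfl

lemma measureReal_comp_reflect (p a : unitInterval) (A : Set (Site N → Bool)) :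
    (bernoulliField (siteWeight N p a a)).real {x | x ∘ reflect ∈ A} =
      (bernoulliField (siteWeight N p a a)).real A := by
  rw [bernoulliField_real_comp _ reflect_injective]
  congr 2
  ext (c | i | i) <;> rfl

/-- Without late exits, the last passage value is carried by the bulk. -/
lemma lastPassage_le_of_not_exitsFrom {K : ℕ} {x : Site N → Bool} (h1 : ¬ ExitsFrom K x)
    (h2 : ¬ ExitsFrom K (x ∘ reflect)) : lastPassage x ≤
      max (sourceCount K x) (sourceCount K (x ∘ reflect)) + bulk (fieldOf x) N N := by
  have hsum : ∀ (s : ℕ → Bool) k, k ≤ K →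
      ∑ l ∈ Finset.range k, (s l).toNat ≤ ∑ l ∈ Finset.range K, (s l).toNat := fun s k hk =>
    Finset.sum_le_sum_of_subset (Finset.range_mono hk)
  rcases exists_lpp_le (sourceOf x) (sinkOf x) (fieldOf x) N N with ⟨k, hk, hle⟩ | ⟨k, hk, hle⟩
  · have hkK : k < K := by
      by_contra hcon
      exact h1 ⟨k, by omega, hk, hle⟩
    have := hsum (sourceOf x) k hkK.le
    have := bulk_fieldFrom_le (ξ := fieldOf x) k N N
    simp only [lastPassage, sourceCount]
    omega
  · have hkK : k < K := by
      by_contra hcon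
      refine h2 ⟨k, by omega, hk, ?_⟩
      rw [lastPassage_comp_reflect, exitValue, sourceOf_comp_reflect, fieldOf_comp_reflect]
      exact hle
    have := hsum (sinkOf x) k hkK.le
    have := bulk_fieldFrom_le (ξ := fun a b => fieldOf x b a) k N N
    rw [bulk_swap (ξ := fieldOf x)] at this
    simp only [lastPassage, sourceCount, sourceOf_comp_reflect]
    omega

/-- Comparison with a configuration with more sources excludes late exits. -/
lemma lastPassage_add_le_of_exitsFrom {K : ℕ} {x y : Site N → Bool} (h : ExitsFrom K x)
    (hf : fieldOf x = fieldOf y) (hs : ∀ k, sourceOf x k = true → sourceOf y k = true) :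
    lastPassage x + sourceCount K y ≤ lastPassage y + sourceCount K x := by
  obtain ⟨k, hKk, hkN, hle⟩ := h
  -- The path leaving the axis at `k` is also available to `y`, with the same bulk part. Its gain is
  -- the number of additional sources before `k`, hence at least the number before `K`.
  have h1 := sum_add_bulk_fieldFrom_le (sourceOf y) (sinkOf y) (fieldOf y) k N N
  rw [min_eq_left hkN] at h1
  rw [exitValue, hf] at hle
  have h2 : ∀ s : ℕ → Bool, ∑ l ∈ Finset.range k, (s l).toNat =
      ∑ l ∈ Finset.range K, (s l).toNat + ∑ l ∈ Finset.Ico K k, (s l).toNat := fun s =>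
    (Finset.sum_range_add_sum_Ico _ hKk).symm
  have h3 : ∑ l ∈ Finset.Ico K k, (sourceOf x l).toNat ≤
      ∑ l ∈ Finset.Ico K k, (sourceOf y l).toNat := by
    refine Finset.sum_le_sum fun l _ => ?_
    have := hs l
    cases h : sourceOf x l <;> simp_all
  have := h2 (sourceOf x)
  have := h2 (sourceOf y)
  simp only [lastPassage, sourceCount] at *
  omega

/-- In a coupling with a common field and more sources in the second model, a late exit forces the
inequality of `lastPassage_add_le_of_exitsFrom`. By `hg` this is impossible outside the four
deviation events. -/
lemma measureReal_exitsFrom_le {p a a' b b' : unitInterval} (haa : a ≤ a') (K : ℕ)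
    {g g' σ σ' : ℝ} (hg : g' + σ < g + σ') :
    (bernoulliField (siteWeight N p a b)).real {x | ExitsFrom K x} ≤
      (bernoulliField (siteWeight N p a b)).real {x | (lastPassage x : ℝ) ≤ g} +
      (bernoulliField (siteWeight N p a' b')).real {x | g' ≤ (lastPassage x : ℝ)} +
      (bernoulliField (siteWeight N p a b)).real {x | σ ≤ (sourceCount K x : ℝ)} +
      (bernoulliField (siteWeight N p a' b')).real {x | (sourceCount K x : ℝ) ≤ σ'} := by
  obtain ⟨m, hm, h1, h2, h3⟩ :=
    exists_bernoulliField_coupling (siteWeight N p a b) (siteWeight N p a' b')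
  rw [← h1, ← h2]
  simp only [map_measureReal_apply (measurable_of_finite _) (MeasurableSet.of_discrete)]
  refine le_trans ?_ (add_le_add (add_le_add (measureReal_union_le _ _) le_rfl) le_rfl)
  refine le_trans ?_ (add_le_add (measureReal_union_le _ _) le_rfl)
  refine le_trans ?_ (measureReal_union_le _ _)
  refine ENNReal.toReal_mono (measure_ne_top _ _) (measure_mono_ae ?_)
  filter_upwards [h3] with x hx hex
  by_contra hcon
  -- The cell parameters are equal, so both directions of the coupling apply and the fields
  -- coincide.
  have hf : fieldOf (fun i => (x i).1) = fieldOf (fun i => (x i).2) := by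
    simp only [fieldOf]
    congr 1
    ext c
    have := hx (.inl c)
    simp only [siteWeight, le_refl, true_implies] at this
    exact Bool.eq_iff_iff.2 ⟨this.1, this.2⟩
  have hs : ∀ k, sourceOf (fun i => (x i).1) k = true →
      sourceOf (fun i => (x i).2) k = true := by
    intro k
    simp only [sourceOf]
    split_ifs with hk
    · exact (hx (.inr (.inl ⟨k, hk⟩))).1 haa
    · exact id
  have key := lastPassage_add_le_of_exitsFrom hex hf hs
  have key' : (lastPassage (fun i => (x i).1) : ℝ) + sourceCount K (fun i => (x i).2) ≤
      lastPassage (fun i => (x i).2) + sourceCount K (fun i => (x i).1) := by exact_mod_cast key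
  have hcon' : ¬ (((lastPassage (fun i => (x i).1) : ℝ) ≤ g ∨
    g' ≤ (lastPassage (fun i => (x i).2) : ℝ) ) ∨ σ ≤ (sourceCount K (fun i => (x i).1) : ℝ)) ∧
    ¬ ((sourceCount K (fun i => (x i).2) : ℝ) ≤ σ') := not_or.1 hcon
  simp only [not_or, not_le] at hcon'
  linarith [hcon'.1.1.1, hcon'.1.1.2, hcon'.1.2, hcon'.2]

end StationaryModel

/-! ### Two-sided bounds for the grid height without boundary -/

section Bulk

variable {N : ℕ}

/-- The greatest number of cells of the field on a strictly increasing path through the grid. -/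
def gridHeight (x : Fin N × Fin N → Bool) : ℕ := bulk (extendField x) N N

lemma measureReal_gridHeight (p a b : unitInterval) (A : Set ℕ) :
    (bernoulliField fun _ : Fin N × Fin N => p).real {x | gridHeight x ∈ A} =
      (bernoulliField (siteWeight N p a b)).real {x | bulk (fieldOf x) N N ∈ A} :=
  (bernoulliField_real_comp (siteWeight N p a b) Sum.inl_injective
    {x : Fin N × Fin N → Bool | gridHeight x ∈ A}).symm

lemma integral_gridHeight_eq (p a b : unitInterval) :
    ∫ x, (gridHeight x : ℝ) ∂(bernoulliField fun _ : Fin N × Fin N => p) =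
      ∫ x, (bulk (fieldOf x) N N : ℝ) ∂(bernoulliField (siteWeight N p a b)) := by
  have h := map_comp_bernoulliField (siteWeight N p a b) (e := Sum.inl (β := Fin N ⊕ Fin N))
    Sum.inl_injective
  rw [show (fun _ : Fin N × Fin N => p) = siteWeight N p a b ∘ Sum.inl from rfl, ← h,
    integral_map (measurable_of_finite _).aemeasurable
      (measurable_of_finite _).aestronglyMeasurable]
  rfl

variable {q : ℝ} {p : unitInterval}

lemma oddsProb_le (hq : 0 ≤ q) : (oddsProb hq : ℝ) ≤ q :=
  div_le_self hq (by linarith)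

lemma le_oddsProb (hq : 0 ≤ q) : q * (1 - q) ≤ oddsProb hq := by
  change q * (1 - q) ≤ q / (1 + q)
  rw [le_div_iff₀ (by linarith)]
  nlinarith [pow_nonneg hq 3]

lemma balancedWeights_diag (hq : 0 ≤ q) (hp : q ^ 2 = p) :
    BalancedWeights (siteWeight N p (oddsProb hq) (oddsProb hq)) :=
  balancedWeights_oddsProb hq hq (by rw [← hp]; ring)

/-- The symmetric balanced model dominates the bulk, and its mean is known exactly. -/
lemma integral_gridHeight_le (hq : 0 ≤ q) (hp : q ^ 2 = p) :
    ∫ x, (gridHeight x : ℝ) ∂(bernoulliField fun _ : Fin N × Fin N => p) ≤ 2 * (q * N) := by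
  rw [integral_gridHeight_eq p (oddsProb hq) (oddsProb hq)]
  refine (integral_mono (g := fun x : Site N → Bool => (lastPassage x : ℝ))
    .of_finite .of_finite fun x => ?_).trans ?_
  · exact Nat.cast_le.2 (bulk_le_lpp (sourceOf x) (sinkOf x) (fieldOf x) N N)
  · rw [integral_lastPassage (balancedWeights_diag hq hp)]
    have := mul_le_mul_of_nonneg_left (oddsProb_le hq) (Nat.cast_nonneg (α := ℝ) N)
    linarith

lemma measureReal_gridHeight_ge_le (hq : 0 < q) (hp : q ^ 2 = p) (hN : 0 < N) {δ : ℝ}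
    (hδ : 0 < δ) : (bernoulliField fun _ : Fin N × Fin N => p).real
      {x | (2 + δ) * (q * N) ≤ gridHeight x} ≤ 8 / (δ ^ 2 * (q * N)) := by
  have hN' : (0 : ℝ) < N := Nat.cast_pos.2 hN
  have hR : 0 < q * N := by positivity
  have hM := mul_le_mul_of_nonneg_left (oddsProb_le hq.le) hN'.le
  have h := measureReal_lastPassage_ge (balancedWeights_diag (N := N) hq.le hp)
    (mul_pos hδ hR) (B := 2 * (q * N)) (by linarith)
  refine (measureReal_gridHeight p (oddsProb hq.le) (oddsProb hq.le)
    {m : ℕ | (2 + δ) * (q * N) ≤ (m : ℝ)}).trans_le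
      ((measureReal_mono fun x hx => ?_).trans (h.trans_eq ?_))
  · have h1 : (bulk (fieldOf x) N N : ℝ) ≤ lastPassage x :=
      Nat.cast_le.2 (bulk_le_lpp (sourceOf x) (sinkOf x) (fieldOf x) N N)
    have h2 : (2 + δ) * (q * N) ≤ (bulk (fieldOf x) N N : ℝ) := hx
    rw [Set.mem_ofPred_eq]
    linarith
  · field_simp; norm_num

/-- Late exits are unlikely. -/
lemma measureReal_exitsFrom_diag_le (hq : 0 < q) (hp : q ^ 2 = p) {δ : ℝ} (hδ : 0 < δ)
    (hδ' : δ ≤ 1 / 4) (hqδ : q ≤ δ ^ 2 / 12) (hR : 1 ≤ q * N) {K : ℕ} (hK : 3 * δ * N ≤ K)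
    (hKN : K ≤ N) :
    (bernoulliField (siteWeight N p (oddsProb hq.le) (oddsProb hq.le))).real
      {x | ExitsFrom K x} ≤ 368 / (δ ^ 4 * (q * N)) := by
  have hN : (0 : ℝ) < N := by
    rcases Nat.eq_zero_or_pos N with h | h
    · rw [h] at hR; norm_num at hR
    · exact Nat.cast_pos.2 h
  have hθ : 0 < 1 + δ := by linarith
  have ha' : 0 ≤ q * (1 + δ) := by positivity
  have hb' : 0 ≤ q / (1 + δ) := by positivity
  have hw := balancedWeights_diag (N := N) hq.le hp
  have hw' : BalancedWeights (siteWeight N p (oddsProb ha') (oddsProb hb')) :=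
    balancedWeights_oddsProb ha' hb' (by rw [← hp]; field_simp)
  have e1 : (oddsProb hq.le : ℝ) ≤ q := oddsProb_le hq.le
  have e2 : (oddsProb ha' : ℝ) ≤ q * (1 + δ) := oddsProb_le ha'
  have e3 : (oddsProb hb' : ℝ) ≤ q / (1 + δ) := oddsProb_le hb'
  have e4 : q * (1 - q) ≤ oddsProb hq.le := le_oddsProb hq.le
  have hq16 : q ≤ 1 / 16 := by nlinarith
  -- The gain in source density is q δ up to a factor 1 + O(q).
  have hdiff : q * δ * (1 - 3 * q) ≤ (oddsProb ha' : ℝ) - oddsProb hq.le := by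
    change q * δ * (1 - 3 * q) ≤ q * (1 + δ) / (1 + q * (1 + δ)) - q / (1 + q)
    rw [div_sub_div _ _ (by positivity) (by positivity), le_div_iff₀ (by positivity),
      show q * (1 + δ) * (1 + q) - (1 + q * (1 + δ)) * q = q * δ * 1 by ring, mul_assoc]
    have h1 : (1 + q * (1 + δ)) * (1 + q) ≤ 1 + 3 * q := by nlinarith
    have h2 : 0 ≤ 1 - 3 * q := by linarith
    have h3 := mul_le_mul_of_nonneg_left h1 h2
    gcongr
    nlinarith
  revert hw hw' e1 e2 e3 e4 hdiff
  generalize oddsProb hq.le = a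
  generalize oddsProb ha' = a'
  generalize oddsProb hb' = b'
  intro hw hw' e1 e2 e3 e4 hdiff
  have haa : a ≤ a' := by
    have : 0 ≤ q * δ * (1 - 3 * q) := mul_nonneg (by positivity) (by linarith)
    exact Subtype.coe_le_coe.1 (by linarith)
  have hKN' : (K : ℝ) ≤ N := Nat.cast_le.2 hKN
  have hc0 : 0 < δ ^ 2 * (q * N) / 4 := by positivity
  have e5 : q / (1 + δ) ≤ q * (1 - δ + δ ^ 2) := by
    rw [div_le_iff₀ hθ]; nlinarith [pow_pos hδ 3]
  have f1 : N * (a : ℝ) ≤ q * N := by rw [mul_comm q]; gcongr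
  have f2 : N * (a' : ℝ) ≤ q * N * (1 + δ) := by
    calc _ ≤ (N : ℝ) * (q * (1 + δ)) := by gcongr
      _ = _ := by ring
  have f3 : N * (b' : ℝ) ≤ q * N * (1 - δ + δ ^ 2) := by
    calc _ ≤ (N : ℝ) * (q * (1 - δ + δ ^ 2)) := by gcongr; linarith
      _ = _ := by ring
  have f4 : q * N * (1 - q) ≤ N * (a : ℝ) := by
    calc _ = (N : ℝ) * (q * (1 - q)) := by ring
      _ ≤ _ := by gcongr
  have f5 : q * N * (3 * δ ^ 2 * (1 - 3 * q)) ≤ K * ((a' : ℝ) - a) := by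
    calc _ = 3 * δ * N * (q * δ * (1 - 3 * q)) := by ring
      _ ≤ _ := by
        have : 0 ≤ q * δ * (1 - 3 * q) := mul_nonneg (by positivity) (by linarith)
        gcongr
  have f6 : K * (a : ℝ) ≤ q * N := le_trans (by have := a.2.1; gcongr) f1
  have f7 : K * (a' : ℝ) ≤ q * N * (1 + δ) := le_trans (by have := a'.2.1; gcongr) f2
  have hR0 : 0 < q * N := by positivity
  generalize hc : δ ^ 2 * (q * N) / 4 = c at hc0
  -- With R = qN, the change in mean is at most R(δ² + 2q) and the four deviations cost 4c = δ²R,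
  -- whereas the additional sources before `K` number at least 3δ²R(1 - 3q) on average. The bound q
  -- ≤ δ²/12 makes the latter larger.
  have hthr : (N * (a' : ℝ) + N * b' + c) + (K * a + c) <
      (N * (a : ℝ) + N * a - c) + (K * a' - c) := by
    have : 0 < q * N * (δ ^ 2 - 2 * q - 9 * δ ^ 2 * q) := mul_pos hR0 (by nlinarith)
    nlinarith
  have p1 := measureReal_lastPassage_le hw hc0 (B := 2 * (q * N)) (by linarith)
  have p2 := measureReal_lastPassage_ge hw' hc0 (B := 3 * (q * N)) (by nlinarith)
  have p3 := measureReal_sourceCount_ge hKN p a a hc0 f6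
  have p4 := measureReal_sourceCount_le hKN p a' b' hc0 (B := 2 * (q * N)) (by nlinarith)
  refine (measureReal_exitsFrom_le (b := a) (b' := b') haa K hthr).trans
    ((add_le_add (add_le_add (add_le_add p1 p2) p3) p4).trans_eq ?_)
  rw [← hc]; field_simp; norm_num

/-- Once late exits are excluded on both axes, the part of an optimal path on the boundary collects
at most about 3δqN points. The rest of the stationary value, about 2qN, must come from the bulk; the
remaining 3δqN of slack absorbs the errors. -/
lemma measureReal_gridHeight_le_le (hq : 0 < q) (hp : q ^ 2 = p) {δ : ℝ} (hδ : 0 < δ)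
    (hδ' : δ ≤ 1 / 4) (hqδ : q ≤ δ ^ 2 / 12) (hR : 1 ≤ q * N) :
    (bernoulliField fun _ : Fin N × Fin N => p).real
      {x | (gridHeight x : ℝ) ≤ (2 - 6 * δ) * (q * N)} ≤ 900 / (δ ^ 4 * (q * N)) := by
  obtain ⟨K, hK, hKN, hK'⟩ : ∃ K : ℕ, 3 * δ * N ≤ K ∧ K ≤ N ∧ (K : ℝ) ≤ 3 * δ * N + 1 := by
    refine ⟨⌈3 * δ * N⌉₊, Nat.le_ceil _, Nat.ceil_le.2 ?_, (Nat.ceil_lt_add_one (by positivity)).le⟩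
    have : (0 : ℝ) ≤ N := Nat.cast_nonneg N
    nlinarith
  have hexit := measureReal_exitsFrom_diag_le hq hp hδ hδ' hqδ hR hK hKN
  have hw := balancedWeights_diag (N := N) hq.le hp
  have e1 : (oddsProb hq.le : ℝ) ≤ q := oddsProb_le hq.le
  have e4 : q * (1 - q) ≤ oddsProb hq.le := le_oddsProb hq.le
  revert hexit hw e1 e4
  generalize oddsProb hq.le = a
  intro hexit hw e1 e4
  have hKN' : (K : ℝ) ≤ N := Nat.cast_le.2 hKN
  have hq16 : q ≤ 1 / 16 := by nlinarith
  have hR0 : 0 < q * N := by linarith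
  have hc0 : 0 < δ ^ 2 * (q * N) / 4 := by positivity
  have f1 : N * (a : ℝ) ≤ q * N := by rw [mul_comm q]; gcongr
  have f4 : q * N * (1 - q) ≤ N * (a : ℝ) := by
    calc _ = (N : ℝ) * (q * (1 - q)) := by ring
      _ ≤ _ := by gcongr
  have f6 : K * (a : ℝ) ≤ q * N := le_trans (by have := a.2.1; gcongr) f1
  have f7 : K * (a : ℝ) ≤ 3 * δ * (q * N) + q := by
    calc _ ≤ (3 * δ * N + 1) * q := by have := a.2.1; gcongr
      _ = _ := by ring
  generalize hc : δ ^ 2 * (q * N) / 4 = c at hc0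
  have p1 := measureReal_lastPassage_le hw hc0 (B := 2 * (q * N)) (by linarith)
  have p3 := measureReal_sourceCount_ge hKN p a a hc0 f6
  have p3' := (measureReal_comp_reflect (N := N) p a _).trans_le p3
  -- Equal odds on both axes make the law symmetric, so the bounds for sources also hold for sinks.
  have hexit' := (measureReal_comp_reflect (N := N) p a _).trans_le hexit
  have hthr : (2 - 6 * δ) * (q * N) + (K * a + c) ≤ N * (a : ℝ) + N * a - c := by
    have : q ≤ 1 / 16 * (q * N) := by nlinarith
    have : 2 * (q * N) * q ≤ 2 * (q * N) * (δ ^ 2 / 12) := by gcongr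
    nlinarith
  refine (measureReal_gridHeight p a a {m : ℕ | (m : ℝ) ≤ (2 - 6 * δ) * (q * N)}).trans_le ?_
  refine le_trans (measureReal_mono (fun x hx => ?_)) ((measureReal_union_le _ _).trans
    ((add_le_add ((measureReal_union_le _ _).trans (add_le_add hexit hexit'))
      ((measureReal_union_le _ _).trans (add_le_add p1
        ((measureReal_union_le _ _).trans (add_le_add p3 p3'))))).trans ?_))
  · by_contra hcon
    simp only [Set.mem_union, Set.mem_ofPred_eq, not_or, not_le] at hcon hx
    obtain ⟨⟨h1, h2⟩, h3, h4, h5⟩ := hcon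
    have h6 : (lastPassage x : ℝ) ≤
        max (sourceCount K x : ℝ) (sourceCount K (x ∘ reflect)) + bulk (fieldOf x) N N := by
      exact_mod_cast lastPassage_le_of_not_exitsFrom h1 h2
    have h7 := max_lt h4 h5
    linarith
  · rw [← hc]
    have h8 : 368 / (δ ^ 4 * (q * N)) + 368 / (δ ^ 4 * (q * N)) +
        (4 * (2 * (q * N)) / (δ ^ 2 * (q * N) / 4) ^ 2 + (q * N / (δ ^ 2 * (q * N) / 4) ^ 2 +
          q * N / (δ ^ 2 * (q * N) / 4) ^ 2)) = 896 / (δ ^ 4 * (q * N)) := by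
      field_simp; norm_num
    rw [h8]
    gcongr
    norm_num

end Bulk

/-! ### Dyadic approximation of the longest increasing path -/

section Dyadic

/-- The cells of the dyadic subdivision of the unit square of level `k`. -/
def dyadicCell (k : ℕ) (c : Fin (2 ^ k) × Fin (2 ^ k)) : Set (ℝ × ℝ) :=
  Set.Ioc (c.1 / 2 ^ k : ℝ) ((c.1 + 1) / 2 ^ k) ×ˢ Set.Ioc (c.2 / 2 ^ k : ℝ) ((c.2 + 1) / 2 ^ k)

lemma mem_dyadicInterval_iff (k i : ℕ) (t : ℝ) :
    t ∈ Set.Ioc (i / 2 ^ k : ℝ) ((i + 1) / 2 ^ k) ↔ ⌈2 ^ k * t⌉₊ = i + 1 := by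
  have h2 : (0 : ℝ) < 2 ^ k := by positivity
  rw [Nat.ceil_eq_iff (Nat.succ_ne_zero i), Set.mem_Ioc, div_lt_iff₀ h2, le_div_iff₀ h2,
    mul_comm t]
  simp

lemma mem_dyadicCell_iff (k : ℕ) (c : Fin (2 ^ k) × Fin (2 ^ k)) (z : ℝ × ℝ) :
    z ∈ dyadicCell k c ↔ ⌈2 ^ k * z.1⌉₊ = c.1 + 1 ∧ ⌈2 ^ k * z.2⌉₊ = c.2 + 1 := by
  rw [dyadicCell, Set.mem_prod, mem_dyadicInterval_iff, mem_dyadicInterval_iff]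

open Classical in
/-- The cells which contain points of `S`. -/
noncomputable def occupied (k : ℕ) (S : Set (ℝ × ℝ)) (c : Fin (2 ^ k) × Fin (2 ^ k)) : Bool :=
  decide ((S ∩ dyadicCell k c).Nonempty)

/-- The greatest number of occupied cells on a strictly increasing path. -/
noncomputable def dyadicHeight (k : ℕ) (S : Set (ℝ × ℝ)) : ℕ := gridHeight (occupied k S)

/-- Strict comparison of points of the plane in both coordinates. -/
def PlaneLT (x y : ℝ × ℝ) : Prop := x.1 < y.1 ∧ x.2 < y.2

/-- The points of `T` lie in different columns and rows of the subdivision of level `k`. -/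
def Separated (k : ℕ) (T : Finset (ℝ × ℝ)) : Prop :=
  ∀ x ∈ T, ∀ y ∈ T, PlaneLT x y →
    ⌈2 ^ k * x.1⌉₊ < ⌈2 ^ k * y.1⌉₊ ∧ ⌈2 ^ k * x.2⌉₊ < ⌈2 ^ k * y.2⌉₊

/-- The integer m = ⌈2^k t⌉ satisfies 2^k t ≤ m < 2^k u, and 2m separates the doubled values.
Separation therefore survives refinement, which makes `dyadicHeight` monotone in the level. -/
lemma ceil_dyadic_lt_succ {k : ℕ} {t u : ℝ} (h : ⌈2 ^ k * t⌉₊ < ⌈2 ^ k * u⌉₊) :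
    ⌈2 ^ (k + 1) * t⌉₊ < ⌈2 ^ (k + 1) * u⌉₊ := by
  have h1 := Nat.le_ceil (2 ^ k * t)
  have h2 := Nat.lt_ceil.1 h
  have h3 : ⌈2 ^ (k + 1) * t⌉₊ ≤ 2 * ⌈2 ^ k * t⌉₊ := Nat.ceil_le.2 (by
    push_cast; rw [pow_succ]; linarith)
  have h4 : 2 * ⌈2 ^ k * t⌉₊ < ⌈2 ^ (k + 1) * u⌉₊ := Nat.lt_ceil.2 (by
    push_cast; rw [pow_succ]; linarith)
  omega

lemma Separated.succ {k : ℕ} {T : Finset (ℝ × ℝ)} (h : Separated k T) : Separated (k + 1) T :=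
  fun x hx y hy hxy => ⟨ceil_dyadic_lt_succ (h x hx y hy hxy).1,
    ceil_dyadic_lt_succ (h x hx y hy hxy).2⟩

lemma eventually_ceil_dyadic_lt {t u : ℝ} (ht : 0 ≤ t) (h : t < u) :
    ∀ᶠ k : ℕ in atTop, ⌈2 ^ k * t⌉₊ < ⌈2 ^ k * u⌉₊ := by
  have h1 : Tendsto (fun k : ℕ => (2 : ℝ) ^ k * (u - t)) atTop atTop :=
    (tendsto_pow_atTop_atTop_of_one_lt one_lt_two).atTop_mul_const (by linarith)
  filter_upwards [h1.eventually_ge_atTop 1] with k hk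
  refine Nat.lt_ceil.2 ((Nat.ceil_lt_add_one (by positivity)).trans_le ?_)
  linarith

/-- The half-open unit square. -/
def unitSquare : Set (ℝ × ℝ) := Set.Ioc 0 1 ×ˢ Set.Ioc 0 1

lemma eventually_separated {T : Finset (ℝ × ℝ)} (hT : (T : Set (ℝ × ℝ)) ⊆ unitSquare) :
    ∀ᶠ k in atTop, Separated k T := by
  unfold Separated
  rw [eventually_all_finset]
  intro x hx
  rw [eventually_all_finset]
  intro y _
  by_cases hxy : PlaneLT x y
  · filter_upwards [eventually_ceil_dyadic_lt (hT hx).1.1.le hxy.1,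
      eventually_ceil_dyadic_lt (hT hx).2.1.le hxy.2] with k h1 h2 _ using ⟨h1, h2⟩
  · exact Eventually.of_forall fun k h => absurd h hxy

lemma exists_dyadic_index {t : ℝ} (ht : t ∈ Set.Ioc (0 : ℝ) 1) (k : ℕ) :
    ⌈2 ^ k * t⌉₊ - 1 < 2 ^ k ∧ ⌈2 ^ k * t⌉₊ = ⌈2 ^ k * t⌉₊ - 1 + 1 := by
  have h1 : 0 < ⌈2 ^ k * t⌉₊ := Nat.ceil_pos.2 (mul_pos (by positivity) ht.1)
  have h2 : ⌈2 ^ k * t⌉₊ ≤ 2 ^ k := Nat.ceil_le.2 (by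
    push_cast
    exact mul_le_of_le_one_right (by positivity) ht.2)
  omega

/-- A separated chain of points maps injectively to a strictly increasing chain of occupied cells.
-/
lemma Separated.card_le_dyadicHeight {k : ℕ} {T : Finset (ℝ × ℝ)} {S : Set (ℝ × ℝ)}
    (h : Separated k T) (hT : (T : Set (ℝ × ℝ)) ⊆ unitSquare) (hS : (T : Set (ℝ × ℝ)) ⊆ S)
    (hc : IsChain PlaneLT (T : Set (ℝ × ℝ))) : T.card ≤ dyadicHeight k S := by
  let f : ℝ × ℝ → ℕ × ℕ := fun z => (⌈2 ^ k * z.1⌉₊ - 1, ⌈2 ^ k * z.2⌉₊ - 1)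
  have hf : ∀ x ∈ T, ∀ y ∈ T, PlaneLT x y → StrictBoth (f x) (f y) := by
    intro x hx y hy hxy
    have h1 := h x hx y hy hxy
    have h2 := exists_dyadic_index (hT hx).1 k
    have h3 := exists_dyadic_index (hT hx).2 k
    simp only [StrictBoth, f]
    omega
  have hinj : Set.InjOn f T := by
    intro x hx y hy hxy
    by_contra hne
    rcases hc hx hy hne with h1 | h1
    · have := hf x hx y hy h1; rw [hxy] at this; exact lt_irrefl _ this.1
    · have := hf y hy x hx h1; rw [hxy] at this; exact lt_irrefl _ this.1
  rw [← Finset.card_image_of_injOn hinj]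
  refine card_le_bulk _ ?_ _ _ ?_
  · rw [Finset.coe_image]
    rintro _ ⟨x, hx, rfl⟩ _ ⟨y, hy, rfl⟩ hne
    have hxy : x ≠ y := fun h => hne (h ▸ rfl)
    exact (hc hx hy hxy).imp (hf x hx y hy) (hf y hy x hx)
  · intro z hz
    obtain ⟨x, hx, rfl⟩ := Finset.mem_image.1 hz
    have h2 := exists_dyadic_index (hT hx).1 k
    have h3 := exists_dyadic_index (hT hx).2 k
    refine ⟨?_, h2.1, h3.1⟩
    simp only [extendField, f, h2.1, h3.1, and_self, dif_pos, occupied, decide_eq_true_eq]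
    exact ⟨x, hS hx, (mem_dyadicCell_iff _ _ _).2 ⟨h2.2, h3.2⟩⟩

/-- Conversely, one point is chosen in each cell of a longest chain of occupied cells; strict order
of the cells gives strict order of the points. -/
lemma exists_separated_card_eq (k : ℕ) (S : Set (ℝ × ℝ)) : ∃ T : Finset (ℝ × ℝ),
    Separated k T ∧ (T : Set (ℝ × ℝ)) ⊆ unitSquare ∧ (T : Set (ℝ × ℝ)) ⊆ S ∧
    IsChain PlaneLT (T : Set (ℝ × ℝ)) ∧ T.card = dyadicHeight k S := by
  classical
  obtain ⟨C, h1, h2, h3⟩ := exists_chain_card_eq_bulk (extendField (occupied k S)) (2 ^ k) (2 ^ k)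
  have hpt : ∀ c : ℕ × ℕ, ∃ z : ℝ × ℝ, c ∈ C →
      z ∈ S ∧ ⌈2 ^ k * z.1⌉₊ = c.1 + 1 ∧ ⌈2 ^ k * z.2⌉₊ = c.2 + 1 := by
    intro c
    by_cases hc : c ∈ C
    · obtain ⟨hξ, hi, hj⟩ := h2 c hc
      simp only [extendField, hi, hj, and_self, dif_pos, occupied, decide_eq_true_eq] at hξ
      obtain ⟨z, hzS, hz⟩ := hξ
      exact ⟨z, fun _ => ⟨hzS, (mem_dyadicCell_iff _ _ _).1 hz⟩⟩
    · exact ⟨0, fun h => absurd h hc⟩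
  choose f hf using hpt
  have hmono : ∀ c ∈ C, ∀ d ∈ C, StrictBoth c d → PlaneLT (f c) (f d) := by
    intro c hc d hd hcd
    have h4 := hf c hc
    have h5 := hf d hd
    have key : ∀ t u : ℝ, ⌈2 ^ k * t⌉₊ < ⌈2 ^ k * u⌉₊ → t < u := by
      intro t u htu
      by_contra hcon
      exact absurd htu (not_lt.2 (Nat.ceil_mono (by gcongr; exact not_lt.1 hcon)))
    unfold StrictBoth at hcd
    exact ⟨key _ _ (by omega), key _ _ (by omega)⟩
  have hinj : Set.InjOn f C := by
    intro x hx y hy hxy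
    by_contra hne
    rcases h1 hx hy hne with h | h
    · have := hmono x hx y hy h; rw [hxy] at this; exact lt_irrefl _ this.1
    · have := hmono y hy x hx h; rw [hxy] at this; exact lt_irrefl _ this.1
  refine ⟨C.image f, ?_, ?_, ?_, ?_, by rw [Finset.card_image_of_injOn hinj, h3]; rfl⟩
  · intro x hx y hy hxy
    obtain ⟨c, hc, rfl⟩ := Finset.mem_image.1 hx
    obtain ⟨d, hd, rfl⟩ := Finset.mem_image.1 hy
    have hcd : c ≠ d := by rintro rfl; exact lt_irrefl _ hxy.1
    have h4 := (hf c hc).2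
    have h5 := (hf d hd).2
    rcases h1 hc hd hcd with h | h
    · unfold StrictBoth at h; omega
    · exact absurd (hmono d hd c hc h).1 (not_lt.2 hxy.1.le)
  · rw [Finset.coe_image]
    rintro _ ⟨c, hc, rfl⟩
    have h4 := (hf c hc).2
    have h5 := (h2 c hc).2
    have key : ∀ (t : ℝ) (i : ℕ), i < 2 ^ k → ⌈2 ^ k * t⌉₊ = i + 1 → t ∈ Set.Ioc (0 : ℝ) 1 := by
      intro t i hi ht
      have h6 : (i : ℝ) + 1 ≤ 2 ^ k := by exact_mod_cast hi
      have h7 := (mem_dyadicInterval_iff k i t).2 ht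
      exact ⟨lt_of_le_of_lt (by positivity) h7.1,
        h7.2.trans (div_le_one_of_le₀ h6 (by positivity))⟩
    exact ⟨key _ _ h5.1 h4.1, key _ _ h5.2 h4.2⟩
  · rw [Finset.coe_image]
    rintro _ ⟨c, hc, rfl⟩
    exact (hf c hc).1
  · rw [Finset.coe_image]
    rintro _ ⟨x, hx, rfl⟩ _ ⟨y, hy, rfl⟩ hne
    have hxy : x ≠ y := fun h => hne (h ▸ rfl)
    exact (h1 hx hy hxy).imp (hmono x hx y hy) (hmono y hy x hx)

lemma dyadicHeight_mono (S : Set (ℝ × ℝ)) : Monotone fun k => dyadicHeight k S := by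
  refine monotone_nat_of_le_succ fun k => ?_
  obtain ⟨T, h1, h2, h3, h4, h5⟩ := exists_separated_card_eq k S
  rw [← h5]
  exact h1.succ.card_le_dyadicHeight h2 h3 h4

lemma increasingHeight_eq_iSup {S : Set (ℝ × ℝ)} (hS : S ⊆ unitSquare) :
    increasingHeight S = ⨆ k, (dyadicHeight k S : ℕ∞) := by
  -- The height may be infinite, so every finite chain length below it is tested; a finite chain is
  -- separated at some level.
  refine le_antisymm (ENat.forall_natCast_le_iff_le.1 fun m hm => ?_) (iSup_le fun k => ?_)
  · obtain ⟨t, ht, hcard, hc⟩ := Set.exists_isChain_of_le_chainHeight m hm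
    have hfin : t.Finite := Set.finite_of_encard_eq_coe hcard
    lift t to Finset (ℝ × ℝ) using hfin
    obtain ⟨k, hk⟩ := (eventually_separated (ht.trans hS)).exists
    have h := hk.card_le_dyadicHeight (ht.trans hS) ht hc
    rw [Set.encard_coe_eq_coe_finsetCard] at hcard
    rw [← hcard]
    exact le_iSup_of_le k (by exact_mod_cast h)
  · obtain ⟨T, -, -, h3, h4, h5⟩ := exists_separated_card_eq k S
    rw [← h5, ← Set.encard_coe_eq_coe_finsetCard]
    exact Set.encard_le_chainHeight_of_isChain _ _ h3 h4

/-- A bounded sequence of natural numbers attains its supremum, so the height is finite and equals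
the dyadic height of some level. The default value of `toNat` at infinity then plays no role. -/
lemma exists_dyadicHeight_eq {S : Set (ℝ × ℝ)} (hS : S ⊆ unitSquare)
    (h : (⨆ k, (dyadicHeight k S : ENNReal)) ≠ ⊤) :
    (∀ k, (dyadicHeight k S : ℝ) ≤ longestIncreasingPath S) ∧
    (∃ k, (dyadicHeight k S : ℝ) = longestIncreasingPath S) ∧
    longestIncreasingPath S = (⨆ k, (dyadicHeight k S : ENNReal)).toReal := by
  obtain ⟨B, hB⟩ : ∃ B : ℕ, ∀ k, dyadicHeight k S ≤ B := by
    obtain ⟨B, hB⟩ := ENNReal.exists_nat_gt h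
    refine ⟨B, fun k => ?_⟩
    have := (le_iSup (fun k => (dyadicHeight k S : ENNReal)) k).trans hB.le
    exact_mod_cast this
  have hbdd : BddAbove (Set.range fun k => dyadicHeight k S) :=
    ⟨B, by rintro _ ⟨k, rfl⟩; exact hB k⟩
  obtain ⟨K, hK⟩ := Nat.sSup_mem (Set.range_nonempty fun k => dyadicHeight k S) hbdd
  have hmax : ∀ k, dyadicHeight k S ≤ dyadicHeight K S := fun k =>
    (le_csSup hbdd ⟨k, rfl⟩).trans_eq hK.symm
  have h1 : increasingHeight S = dyadicHeight K S := by
    rw [increasingHeight_eq_iSup hS]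
    exact le_antisymm (iSup_le fun k => by exact_mod_cast hmax k)
      (le_iSup (fun k => (dyadicHeight k S : ℕ∞)) K)
  have h2 : longestIncreasingPath S = dyadicHeight K S := by
    rw [longestIncreasingPath, h1, ENat.toNat_natCast]
  have h3 : ⨆ k, (dyadicHeight k S : ENNReal) = dyadicHeight K S :=
    le_antisymm (iSup_le fun k => by exact_mod_cast hmax k)
      (le_iSup (fun k => (dyadicHeight k S : ENNReal)) K)
  rw [h2, h3]
  exact ⟨fun k => by exact_mod_cast hmax k, ⟨K, rfl⟩, by simp⟩

end Dyadic

/-! ### Occupied dyadic cells of the Poisson process -/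

section Poisson

variable {Ω : Type*} [MeasurableSpace Ω] {P : Measure Ω} {Ξ : Ω → Set (ℝ × ℝ)} {n : ℕ}

/-- The probability that a cell of level `k` contains points, for intensity `n`. -/
noncomputable def cellProb (n k : ℕ) : unitInterval :=
  ⟨1 - Real.exp (-(n / 4 ^ k)), by
    have := Real.exp_le_one_iff.2 (neg_nonpos.2 (show (0 : ℝ) ≤ n / 4 ^ k by positivity))
    linarith, by linarith [Real.exp_pos (-(n / 4 ^ k : ℝ))]⟩

lemma measurableSet_dyadicCell (k : ℕ) (c : Fin (2 ^ k) × Fin (2 ^ k)) :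
    MeasurableSet (dyadicCell k c) := measurableSet_Ioc.prod measurableSet_Ioc

lemma dyadicCell_subset (k : ℕ) (c : Fin (2 ^ k) × Fin (2 ^ k)) :
    dyadicCell k c ⊆ Set.Icc (0 : ℝ) 1 ×ˢ Set.Icc (0 : ℝ) 1 := by
  have key : ∀ i : Fin (2 ^ k), Set.Ioc (i / 2 ^ k : ℝ) ((i + 1) / 2 ^ k) ⊆ Set.Icc 0 1 := by
    intro i t ht
    have h6 : (i : ℝ) + 1 ≤ 2 ^ k := by exact_mod_cast i.2
    exact ⟨le_trans (by positivity) ht.1.le,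
      ht.2.trans (div_le_one_of_le₀ h6 (by positivity))⟩
  exact Set.prod_mono (key _) (key _)

lemma squareIntensity_dyadicCell (n k : ℕ) (c : Fin (2 ^ k) × Fin (2 ^ k)) :
    squareIntensity n (dyadicCell k c) = ENNReal.ofReal (n / 4 ^ k) := by
  have h2 : (0 : ℝ) < 2 ^ k := by positivity
  rw [squareIntensity, Measure.smul_apply, Measure.restrict_apply (measurableSet_dyadicCell k c),
    Set.inter_eq_left.2 (dyadicCell_subset k c), dyadicCell, Measure.volume_eq_prod,
    Measure.prod_prod, Real.volume_Ioc, Real.volume_Ioc, ← sub_div, ← sub_div, add_sub_cancel_left,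
    add_sub_cancel_left, ← ENNReal.ofReal_mul (by positivity), smul_eq_mul,
    ← ENNReal.ofReal_natCast, ← ENNReal.ofReal_mul (by positivity)]
  congr 1
  rw [show (4 : ℝ) = 2 * 2 by norm_num, mul_pow]
  field_simp

lemma squareIntensity_compl_unitSquare (n : ℕ) : squareIntensity n unitSquareᶜ = 0 := by
  rw [squareIntensity, Measure.smul_apply, Measure.restrict_congr_set (t := unitSquare),
    Measure.restrict_apply (show MeasurableSet unitSquareᶜ from
      (measurableSet_Ioc.prod measurableSet_Ioc).compl)]
  · simp
  · rw [Measure.volume_eq_prod]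
    exact Measure.set_prod_ae_eq Ioc_ae_eq_Icc.symm Ioc_ae_eq_Icc.symm

lemma disjoint_dyadicCell (k : ℕ) :
    Pairwise fun c d => Disjoint (dyadicCell k c) (dyadicCell k d) := by
  intro c d hcd
  rw [Set.disjoint_left]
  intro z hc hd
  rw [mem_dyadicCell_iff] at hc hd
  exact hcd (Prod.ext (Fin.ext (by omega)) (Fin.ext (by omega)))

namespace IsPoissonProcess

lemma measure_inter_eq_empty (h : IsPoissonProcess P Ξ (squareIntensity n))
    {B : Set (ℝ × ℝ)} (hB : MeasurableSet B)
    (hν : squareIntensity n B ≠ ⊤) : P {ω | Ξ ω ∩ B = ∅} =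
      ENNReal.ofReal (Real.exp (-(squareIntensity n B).toReal)) := by
  have h1 := congrArg (fun m => m {0}) (h.map_count B hB hν)
  simp only [Measure.map_apply (h.measurable_count B hB) (MeasurableSet.of_discrete)] at h1
  rw [Measure.map_apply (measurable_from_nat) (MeasurableSet.of_discrete)] at h1
  have h2 : (fun m : ℕ => (m : ℕ∞)) ⁻¹' {0} = {0} := by ext m; simp
  have h3 : (fun ω => (Ξ ω ∩ B).encard) ⁻¹' {0} = {ω | Ξ ω ∩ B = ∅} := by ext ω; simp
  rw [h2, h3, poissonMeasure_singleton] at h1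
  rw [ENNReal.coe_toNNReal_eq_toReal] at h1
  simpa using h1

/-- The dyadic cells cover only the half-open square; the left and bottom edges have intensity zero
and so almost surely carry no points. -/
lemma ae_subset_unitSquare (h : IsPoissonProcess P Ξ (squareIntensity n))
    [IsProbabilityMeasure P] : ∀ᵐ ω ∂P, Ξ ω ⊆ unitSquare := by
  have hm : MeasurableSet unitSquareᶜ := (measurableSet_Ioc.prod measurableSet_Ioc).compl
  have h0 := squareIntensity_compl_unitSquare n
  have h1 := h.measure_inter_eq_empty hm (by simp [h0])
  rw [h0] at h1
  simp only [ENNReal.toReal_zero, neg_zero, Real.exp_zero, ENNReal.ofReal_one] at h1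
  have h2 : MeasurableSet {ω | Ξ ω ∩ unitSquareᶜ = ∅} := by
    have := h.measurable_count _ hm (MeasurableSet.singleton 0)
    convert! this using 1
    ext ω; simp
  filter_upwards [(prob_compl_eq_zero_iff h2).2 h1] with ω hω
  have hω' : Ξ ω ∩ unitSquareᶜ = ∅ := by simpa using hω
  rwa [← Set.sdiff_eq, Set.sdiff_eq_empty] at hω'

lemma measurable_occupied (h : IsPoissonProcess P Ξ (squareIntensity n))
    (k : ℕ) (c : Fin (2 ^ k) × Fin (2 ^ k)) :
    Measurable fun ω => occupied k (Ξ ω) c := by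
  have h1 : (fun ω => occupied k (Ξ ω) c) =
      (fun m : ℕ∞ => decide (m ≠ 0)) ∘ fun ω => (Ξ ω ∩ dyadicCell k c).encard := by
    ext ω
    simp [occupied, Set.nonempty_iff_ne_empty]
  rw [h1]
  exact Measurable.of_discrete.comp (h.measurable_count _ (measurableSet_dyadicCell k c))

lemma iIndepFun_occupied (h : IsPoissonProcess P Ξ (squareIntensity n)) (k : ℕ) :
    iIndepFun (fun c ω => occupied k (Ξ ω) c) P := by
  have h1 := h.indep_count _ (fun i => dyadicCell k ((Fintype.equivFin _).symm i))
    (fun i => measurableSet_dyadicCell k _)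
    (fun i j hij => disjoint_dyadicCell k ((Fintype.equivFin _).symm.injective.ne hij))
  have h2 := (h1.precomp (Fintype.equivFin (Fin (2 ^ k) × Fin (2 ^ k))).injective).comp
    (fun _ (m : ℕ∞) => decide (m ≠ 0)) (fun _ => .of_discrete)
  convert! h2 using 2 with c
  ext ω
  simp [occupied, Set.nonempty_iff_ne_empty]

/-- Occupation depends only on the number of points in a cell. Disjoint cells give independence, and
the probability of an empty cell gives the parameter. -/
lemma map_occupied (h : IsPoissonProcess P Ξ (squareIntensity n)) [IsProbabilityMeasure P] (k : ℕ) :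
    P.map (fun ω => occupied k (Ξ ω)) =
      bernoulliField fun _ : Fin (2 ^ k) × Fin (2 ^ k) => cellProb n k := by
  have h1 := (iIndepFun_iff_map_fun_eq_pi_map
    fun c => (h.measurable_occupied k c).aemeasurable).1 (h.iIndepFun_occupied k)
  refine h1.trans ?_
  unfold bernoulliField
  congr 1
  ext1 c
  have : IsProbabilityMeasure (P.map fun ω => occupied k (Ξ ω) c) :=
    Measure.isProbabilityMeasure_map (h.measurable_occupied k c).aemeasurable
  refine bernoulliMeasure_bool_ext ?_
  have hν := squareIntensity_dyadicCell n k c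
  have h2 := h.measure_inter_eq_empty (measurableSet_dyadicCell k c) (by simp [hν])
  rw [hν, ENNReal.toReal_ofReal (by positivity)] at h2
  have h3 : {ω | Ξ ω ∩ dyadicCell k c = ∅} = ((fun ω => occupied k (Ξ ω) c) ⁻¹' {true})ᶜ := by
    ext ω
    simp [occupied, Set.nonempty_iff_ne_empty]
  have hm := h.measurable_occupied k c (MeasurableSet.singleton true)
  have h4 := probReal_compl_eq_one_sub (μ := P) hm
  rw [← h3, measureReal_def, h2, ENNReal.toReal_ofReal (Real.exp_pos _).le] at h4
  rw [map_measureReal_apply (h.measurable_occupied k c) (MeasurableSet.singleton true)]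
  change _ = 1 - Real.exp (-(n / 4 ^ k))
  linarith

end IsPoissonProcess

end Poisson

/-! ### Asymptotics of the cell probabilities -/

section CellProb

variable (n : ℕ)

lemma cellProb_le (k : ℕ) : (cellProb n k : ℝ) ≤ n / 4 ^ k := by
  change 1 - Real.exp (-(n / 4 ^ k)) ≤ n / 4 ^ k
  linarith [Real.add_one_le_exp (-(n / 4 ^ k : ℝ))]

/-- From exp(-x) ≤ 1/(1 + x). This lower bound tends to n as the level grows, which gives qN → √n.
-/
lemma le_cellProb_mul (k : ℕ) : n / (1 + n / 4 ^ k) ≤ (cellProb n k : ℝ) * 4 ^ k := by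
  have hx : (0 : ℝ) ≤ n / 4 ^ k := by positivity
  have h1 : Real.exp (-(n / 4 ^ k : ℝ)) ≤ 1 / (1 + n / 4 ^ k) := by
    rw [Real.exp_neg, ← one_div]
    exact one_div_le_one_div_of_le (by positivity)
      (by linarith [Real.add_one_le_exp (n / 4 ^ k : ℝ)])
  have h2 : (n : ℝ) / (1 + n / 4 ^ k) = (1 - 1 / (1 + n / 4 ^ k)) * 4 ^ k := by
    field_simp
    ring
  rw [h2]
  change _ ≤ (1 - Real.exp (-(n / 4 ^ k))) * 4 ^ k
  gcongr

lemma sqrt_cellProb_mul_eq (k : ℕ) :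
    √(cellProb n k : ℝ) * (2 ^ k : ℕ) = √((cellProb n k : ℝ) * 4 ^ k) := by
  rw [Real.sqrt_mul (cellProb n k).2.1, show (4 : ℝ) ^ k = (2 ^ k) ^ 2 by
    rw [← pow_mul, mul_comm, pow_mul]; norm_num, Real.sqrt_sq (by positivity)]
  push_cast
  rfl

lemma sqrt_cellProb_mul_le (k : ℕ) : √(cellProb n k : ℝ) * (2 ^ k : ℕ) ≤ √n := by
  rw [sqrt_cellProb_mul_eq]
  refine Real.sqrt_le_sqrt ?_
  have := cellProb_le n k
  rwa [le_div_iff₀ (by positivity)] at this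

lemma tendsto_natCast_div_four_pow : Tendsto (fun k : ℕ => (n : ℝ) / 4 ^ k) atTop (𝓝 0) :=
  (tendsto_pow_atTop_atTop_of_one_lt (by norm_num)).const_div_atTop _

lemma tendsto_sqrt_cellProb_mul :
    Tendsto (fun k => √(cellProb n k : ℝ) * (2 ^ k : ℕ)) atTop (𝓝 √n) := by
  simp_rw [sqrt_cellProb_mul_eq]
  refine (Real.continuous_sqrt.tendsto _).comp ?_
  have h1 : Tendsto (fun k : ℕ => (n : ℝ) / (1 + n / 4 ^ k)) atTop (𝓝 n) := by
    have := (tendsto_const_nhds (x := (n : ℝ))).div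
      ((tendsto_natCast_div_four_pow n).const_add 1) (by norm_num)
    rw [add_zero, div_one] at this
    exact this
  refine tendsto_of_tendsto_of_tendsto_of_le_of_le h1 tendsto_const_nhds (le_cellProb_mul n)
    fun k => ?_
  have := cellProb_le n k
  rwa [le_div_iff₀ (by positivity)] at this

lemma tendsto_sqrt_cellProb : Tendsto (fun k => √(cellProb n k : ℝ)) atTop (𝓝 0) := by
  have h := (Real.continuous_sqrt.tendsto _).comp (squeeze_zero (fun k => (cellProb n k).2.1)
    (cellProb_le n) (tendsto_natCast_div_four_pow n))
  rw [Real.sqrt_zero] at h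
  exact h

end CellProb

/-! ### Moment and tail bounds for the Poisson process -/

section Poisson

variable {Ω : Type*} [MeasurableSpace Ω] {P : Measure Ω} {Ξ : Ω → Set (ℝ × ℝ)} {n : ℕ}

namespace IsPoissonProcess

lemma measurable_occupied_pi (h : IsPoissonProcess P Ξ (squareIntensity n)) (k : ℕ) :
    Measurable fun ω => occupied k (Ξ ω) :=
  measurable_pi_lambda _ fun c => h.measurable_occupied k c

lemma measurable_dyadicHeight (h : IsPoissonProcess P Ξ (squareIntensity n)) (k : ℕ) :
    Measurable fun ω => dyadicHeight k (Ξ ω) :=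
  (measurable_of_finite gridHeight).comp (h.measurable_occupied_pi k)

lemma measurable_iSup_dyadicHeight (h : IsPoissonProcess P Ξ (squareIntensity n)) :
    Measurable fun ω => ⨆ k, (dyadicHeight k (Ξ ω) : ENNReal) :=
  .iSup fun k => measurable_from_nat.comp (h.measurable_dyadicHeight k)

variable [IsProbabilityMeasure P]

lemma measureReal_dyadicHeight (h : IsPoissonProcess P Ξ (squareIntensity n)) (k : ℕ)
    (A : Set ℕ) : P.real {ω | dyadicHeight k (Ξ ω) ∈ A} =
      (bernoulliField fun _ : Fin (2 ^ k) × Fin (2 ^ k) => cellProb n k).real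
        {x | gridHeight x ∈ A} := by
  rw [← h.map_occupied k, map_measureReal_apply (h.measurable_occupied_pi k) .of_discrete]
  rfl

lemma lintegral_dyadicHeight_le (h : IsPoissonProcess P Ξ (squareIntensity n)) (k : ℕ) :
    ∫⁻ ω, (dyadicHeight k (Ξ ω) : ENNReal) ∂P ≤ ENNReal.ofReal (2 * √n) := by
  have h1 : ∫⁻ ω, (dyadicHeight k (Ξ ω) : ENNReal) ∂P = ∫⁻ x, (gridHeight x : ENNReal)
      ∂(bernoulliField fun _ : Fin (2 ^ k) × Fin (2 ^ k) => cellProb n k) := by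
    rw [← h.map_occupied k, lintegral_map (measurable_of_finite _) (h.measurable_occupied_pi k)]
    rfl
  have h2 := integral_gridHeight_le (N := 2 ^ k) (Real.sqrt_nonneg _)
    (Real.sq_sqrt (cellProb n k).2.1)
  rw [h1, ← ENNReal.ofReal_toReal (a := lintegral _ _)]
  · refine ENNReal.ofReal_le_ofReal ?_
    rw [integral_eq_lintegral_of_nonneg_ae (ae_of_all _ fun x => Nat.cast_nonneg _)
      (measurable_of_finite _).aestronglyMeasurable] at h2
    simp only [ENNReal.ofReal_natCast] at h2
    exact h2.trans (by gcongr; exact sqrt_cellProb_mul_le n k)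
  · have h3 : Integrable (fun x => (gridHeight x : ℝ))
        (bernoulliField fun _ : Fin (2 ^ k) × Fin (2 ^ k) => cellProb n k) := .of_finite
    have h4 := h3.lintegral_lt_top
    simp only [ENNReal.ofReal_natCast] at h4
    exact h4.ne

/-- Monotone convergence over the levels, as the bound 2√n is uniform. It yields almost sure
finiteness, integrability and the upper bound for the mean at once. -/
lemma lintegral_iSup_dyadicHeight_le (h : IsPoissonProcess P Ξ (squareIntensity n)) :
    ∫⁻ ω, ⨆ k, (dyadicHeight k (Ξ ω) : ENNReal) ∂P ≤ ENNReal.ofReal (2 * √n) := by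
  have hm : ∀ k, Measurable fun ω => (dyadicHeight k (Ξ ω) : ENNReal) := fun k =>
    measurable_from_nat.comp (h.measurable_dyadicHeight k)
  rw [lintegral_iSup hm
    fun i j hij ω => Nat.cast_le.2 (dyadicHeight_mono (Ξ ω) hij)]
  exact iSup_le h.lintegral_dyadicHeight_le

lemma ae_longestIncreasingPath (h : IsPoissonProcess P Ξ (squareIntensity n)) : ∀ᵐ ω ∂P,
    (∀ k, (dyadicHeight k (Ξ ω) : ℝ) ≤ longestIncreasingPath (Ξ ω)) ∧
    (∃ k, (dyadicHeight k (Ξ ω) : ℝ) = longestIncreasingPath (Ξ ω)) ∧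
    longestIncreasingPath (Ξ ω) = (⨆ k, (dyadicHeight k (Ξ ω) : ENNReal)).toReal := by
  filter_upwards [h.ae_subset_unitSquare, ae_lt_top h.measurable_iSup_dyadicHeight
    (h.lintegral_iSup_dyadicHeight_le.trans_lt ENNReal.ofReal_lt_top).ne] with ω h1 h2
  exact exists_dyadicHeight_eq h1 h2.ne

lemma integrable_longestIncreasingPath (h : IsPoissonProcess P Ξ (squareIntensity n)) :
    Integrable (fun ω => longestIncreasingPath (Ξ ω)) P :=
  (integrable_toReal_of_lintegral_ne_top h.measurable_iSup_dyadicHeight.aemeasurable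
    (h.lintegral_iSup_dyadicHeight_le.trans_lt ENNReal.ofReal_lt_top).ne).congr <| by
      filter_upwards [h.ae_longestIncreasingPath] with ω hω using hω.2.2.symm

lemma integral_longestIncreasingPath_le (h : IsPoissonProcess P Ξ (squareIntensity n)) :
    ∫ ω, longestIncreasingPath (Ξ ω) ∂P ≤ 2 * √n := by
  have hfin := (h.lintegral_iSup_dyadicHeight_le.trans_lt ENNReal.ofReal_lt_top).ne
  rw [integral_congr_ae (g := fun ω => (⨆ k, (dyadicHeight k (Ξ ω) : ENNReal)).toReal) (by
    filter_upwards [h.ae_longestIncreasingPath] with ω hω using hω.2.2),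
    integral_toReal h.measurable_iSup_dyadicHeight.aemeasurable
      (ae_lt_top h.measurable_iSup_dyadicHeight hfin)]
  exact ENNReal.toReal_le_of_le_ofReal (by positivity) h.lintegral_iSup_dyadicHeight_le

lemma sqrt_cellProb_pos (hn : 1 ≤ n) (k : ℕ) : 0 < √(cellProb n k : ℝ) := by
  have h1 := le_cellProb_mul n k
  have h2 : (0 : ℝ) < n := Nat.cast_pos.2 hn
  have h3 : (0 : ℝ) < n / (1 + n / 4 ^ k) := by positivity
  exact Real.sqrt_pos.2 (pos_of_mul_pos_left (h3.trans_le h1) (by positivity))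

/-- The height is attained at some level and the level events increase, so continuity from below
passes the grid bound to the limit. The inequality qN ≤ √n makes the threshold valid at every level.
-/
lemma measureReal_longestIncreasingPath_ge_le (h : IsPoissonProcess P Ξ (squareIntensity n))
    (hn : 1 ≤ n) {δ : ℝ} (hδ : 0 < δ) :
    P.real {ω | (2 + δ) * √n ≤ longestIncreasingPath (Ξ ω)} ≤ 8 / (δ ^ 2 * √n) := by
  have hsq : (0 : ℝ) < √n := Real.sqrt_pos.2 (Nat.cast_pos.2 hn)
  have h1 : P.real {ω | (2 + δ) * √n ≤ longestIncreasingPath (Ξ ω)} ≤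
      P.real (⋃ k, {ω | (2 + δ) * √n ≤ dyadicHeight k (Ξ ω)}) := by
    refine ENNReal.toReal_mono (measure_ne_top _ _) (measure_mono_ae ?_)
    filter_upwards [h.ae_longestIncreasingPath] with ω hω hle
    obtain ⟨k, hk⟩ := hω.2.1
    exact Set.mem_iUnion.2 ⟨k, le_of_le_of_eq hle hk.symm⟩
  have hmono : Monotone fun k => {ω | (2 + δ) * √n ≤ (dyadicHeight k (Ξ ω) : ℝ)} :=
    fun i j hij ω hω => show (2 + δ) * √n ≤ (dyadicHeight j (Ξ ω) : ℝ) from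
      le_trans hω (Nat.cast_le.2 (dyadicHeight_mono (Ξ ω) hij))
  have h2 : Tendsto (fun k => P.real {ω | (2 + δ) * √n ≤ (dyadicHeight k (Ξ ω) : ℝ)}) atTop
      (𝓝 (P.real (⋃ k, {ω | (2 + δ) * √n ≤ dyadicHeight k (Ξ ω)}))) :=
    (ENNReal.tendsto_toReal (measure_ne_top _ _)).comp (tendsto_measure_iUnion_atTop hmono)
  have h3 : Tendsto (fun k => 8 / (δ ^ 2 * (√(cellProb n k : ℝ) * (2 ^ k : ℕ)))) atTop
      (𝓝 (8 / (δ ^ 2 * √n))) :=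
    tendsto_const_nhds.div ((tendsto_sqrt_cellProb_mul n).const_mul _) (by positivity)
  refine h1.trans (le_of_tendsto_of_tendsto' h2 h3 fun k => ?_)
  refine le_trans (measureReal_mono fun ω hω => ?_)
    ((h.measureReal_dyadicHeight k
      {m : ℕ | (2 + δ) * (√(cellProb n k : ℝ) * (2 ^ k : ℕ)) ≤ m}).trans_le
      (measureReal_gridHeight_ge_le (sqrt_cellProb_pos hn k)
        (Real.sq_sqrt (cellProb n k).2.1) (by positivity) hδ))
  refine le_trans ?_ hω.out
  have := sqrt_cellProb_mul_le n k
  gcongr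

lemma measureReal_longestIncreasingPath_le_le (h : IsPoissonProcess P Ξ (squareIntensity n))
    (hn : 2 ≤ n) {δ : ℝ} (hδ : 0 < δ) (hδ' : δ ≤ 1 / 4) :
    P.real {ω | longestIncreasingPath (Ξ ω) ≤ (2 - 7 * δ) * √n} ≤ 900 / (δ ^ 4 * √n) := by
  -- A strict inequality, so that qN ≥ 1 holds at all large levels; this is where n ≥ 2 enters.
  have hsq : (1 : ℝ) < √n := by
    rw [Real.lt_sqrt zero_le_one]
    have : (2 : ℝ) ≤ n := by exact_mod_cast hn
    linarith
  have hlim := tendsto_sqrt_cellProb_mul n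
  have h3 : Tendsto (fun k => 900 / (δ ^ 4 * (√(cellProb n k : ℝ) * (2 ^ k : ℕ)))) atTop
      (𝓝 (900 / (δ ^ 4 * √n))) := tendsto_const_nhds.div (hlim.const_mul _) (by positivity)
  refine ge_of_tendsto h3 ?_
  filter_upwards [hlim.eventually_const_le hsq,
    (tendsto_sqrt_cellProb n).eventually_le_const (show 0 < δ ^ 2 / 12 by positivity),
    -- Passing from 6δ to 7δ absorbs the difference between qN and √n.
    (hlim.const_mul (2 - 6 * δ)).eventually_const_le
      (show (2 - 7 * δ) * √n < (2 - 6 * δ) * √n by nlinarith)] with k hk1 hk2 hk3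
  refine le_trans ?_ ((h.measureReal_dyadicHeight k
      {m : ℕ | (m : ℝ) ≤ (2 - 6 * δ) * (√(cellProb n k : ℝ) * (2 ^ k : ℕ))}).trans_le
      (measureReal_gridHeight_le_le (sqrt_cellProb_pos (by omega) k)
        (Real.sq_sqrt (cellProb n k).2.1) hδ hδ' hk2 hk1))
  refine ENNReal.toReal_mono (measure_ne_top _ _) (measure_mono_ae ?_)
  filter_upwards [h.ae_longestIncreasingPath] with ω hω hle
  exact (hω.1 k).trans (le_trans hle hk3)

end IsPoissonProcess

end Poisson

/-! ### Convergence in probability and of the mean -/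

section Limits

variable {Ω : ℕ → Type*} [∀ n, MeasurableSpace (Ω n)] {P : ∀ n, Measure (Ω n)}
  [∀ n, IsProbabilityMeasure (P n)] {Ξ : ∀ n, Ω n → Set (ℝ × ℝ)}

lemma tendsto_sqrt_natCast : Tendsto (fun n : ℕ => √(n : ℝ)) atTop atTop :=
  Real.tendsto_sqrt_atTop.comp tendsto_natCast_atTop_atTop

lemma tendsto_const_div_mul_sqrt (a b : ℝ) (hb : 0 < b) :
    Tendsto (fun n : ℕ => a / (b * √(n : ℝ))) atTop (𝓝 0) :=
  (tendsto_sqrt_natCast.const_mul_atTop hb).const_div_atTop a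

theorem tendsto_measure_longestIncreasingPath
    (h : ∀ n, 1 ≤ n → IsPoissonProcess (P n) (Ξ n) (squareIntensity n)) {ε : ℝ} (hε : 0 < ε) :
    Tendsto (fun n : ℕ =>
      P n {ω | ε ≤ |longestIncreasingPath (Ξ n ω) / √n - 2|}) atTop (𝓝 0) := by
  set δ := min (ε / 7) (1 / 4) with hδdef
  have hδ : 0 < δ := by positivity
  have hδε : 7 * δ ≤ ε := by have := min_le_left (ε / 7) (1 / 4 : ℝ); linarith
  have hlim := (tendsto_const_div_mul_sqrt 8 (ε ^ 2) (by positivity)).add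
    (tendsto_const_div_mul_sqrt 900 (δ ^ 4) (by positivity))
  rw [add_zero] at hlim
  have hreal : Tendsto (fun n : ℕ =>
      (P n).real {ω | ε ≤ |longestIncreasingPath (Ξ n ω) / √n - 2|}) atTop (𝓝 0) := by
    refine squeeze_zero' (Eventually.of_forall fun n => measureReal_nonneg) ?_ hlim
    filter_upwards [eventually_ge_atTop 2] with n hn
    have hsq : (0 : ℝ) < √n := Real.sqrt_pos.2 (Nat.cast_pos.2 (by omega))
    have hΞ := h n (by omega)
    refine le_trans (measureReal_mono fun ω hω => ?_) ((measureReal_union_le _ _).trans (add_le_add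
      (hΞ.measureReal_longestIncreasingPath_ge_le (by omega) hε)
      (hΞ.measureReal_longestIncreasingPath_le_le hn hδ (min_le_right _ _))))
    rcases le_abs'.1 hω.out with h1 | h1
    · right
      have h2 : longestIncreasingPath (Ξ n ω) / √n ≤ 2 - 7 * δ := by linarith
      exact (div_le_iff₀ hsq).1 h2
    · left
      have h2 : 2 + ε ≤ longestIncreasingPath (Ξ n ω) / √n := by linarith
      exact (le_div_iff₀ hsq).1 h2
  rw [← ENNReal.tendsto_toReal_iff (fun n => measure_ne_top _ _) ENNReal.zero_ne_top]
  exact hreal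

theorem tendsto_integral_longestIncreasingPath
    (h : ∀ n, 1 ≤ n → IsPoissonProcess (P n) (Ξ n) (squareIntensity n)) :
    Tendsto (fun n : ℕ =>
      (∫ ω, longestIncreasingPath (Ξ n ω) ∂(P n)) / √n) atTop (𝓝 2) := by
  refine tendsto_order.2 ⟨fun a ha => ?_, fun a ha => ?_⟩
  · set δ := min ((2 - a) / 14) (1 / 4) with hδdef
    have hδ : 0 < δ := lt_min (by linarith) (by norm_num)
    have hδ' : δ ≤ 1 / 4 := min_le_right _ _
    have hδa : 14 * δ ≤ 2 - a := by have := min_le_left ((2 - a) / 14) (1 / 4 : ℝ); linarith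
    have hlim := ((tendsto_const_div_mul_sqrt 900 (δ ^ 4) (by positivity)).const_sub 1).const_mul
      (2 - 7 * δ)
    filter_upwards [eventually_ge_atTop 2, hlim.eventually_const_lt
      (show a < (2 - 7 * δ) * (1 - 0) by linarith)] with n hn ha'
    have hsq : (0 : ℝ) < √n := Real.sqrt_pos.2 (Nat.cast_pos.2 (by omega))
    have hΞ := h n (by omega)
    -- The lower bound for the mean is Markov's inequality combined with the lower tail; the upper
    -- bound needs no tail estimate, as the mean is at most 2√n for every n ≥ 1.
    have h1 := mul_meas_ge_le_integral_of_nonneg (μ := P n)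
      (ae_of_all _ fun ω => Nat.cast_nonneg (increasingHeight (Ξ n ω)).toNat)
      hΞ.integrable_longestIncreasingPath ((2 - 7 * δ) * √n)
    have h2 := hΞ.measureReal_longestIncreasingPath_le_le hn hδ hδ'
    have h3 : 1 - 900 / (δ ^ 4 * √n) ≤
        (P n).real {ω | (2 - 7 * δ) * √n ≤ longestIncreasingPath (Ξ n ω)} := by
      have h4 := measureReal_union_le (μ := P n)
        {ω | longestIncreasingPath (Ξ n ω) ≤ (2 - 7 * δ) * √n}
        {ω | (2 - 7 * δ) * √n ≤ longestIncreasingPath (Ξ n ω)}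
      rw [show {ω | longestIncreasingPath (Ξ n ω) ≤ (2 - 7 * δ) * √n} ∪
        {ω | (2 - 7 * δ) * √n ≤ longestIncreasingPath (Ξ n ω)} = Set.univ from
          Set.eq_univ_of_forall fun ω => le_total (longestIncreasingPath (Ξ n ω)) _,
        probReal_univ] at h4
      linarith
    rw [lt_div_iff₀ hsq]
    calc a * √n < (2 - 7 * δ) * (1 - 900 / (δ ^ 4 * √n)) * √n := by gcongr
      _ = (2 - 7 * δ) * √n * (1 - 900 / (δ ^ 4 * √n)) := by ring
      _ ≤ (2 - 7 * δ) * √n *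
          (P n).real {ω | (2 - 7 * δ) * √n ≤ longestIncreasingPath (Ξ n ω)} := by
        have : 0 ≤ 2 - 7 * δ := by linarith
        gcongr
      _ ≤ _ := h1
  · filter_upwards [eventually_ge_atTop 1] with n hn
    have hsq : (0 : ℝ) < √n := Real.sqrt_pos.2 (Nat.cast_pos.2 (by omega))
    rw [div_lt_iff₀ hsq]
    exact (h n hn).integral_longestIncreasingPath_le.trans_lt (by gcongr)

end Limits

/-! ### Order patterns of permutations and matchings in the grid -/

section Subsequences

variable {n N : ℕ}

open Classical in
/-- The length of the longest increasing subsequence of the sequence `g`. -/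
noncomputable def lisLength {α : Type*} [Preorder α] (g : Fin n → α) : ℕ :=
  (Finset.univ.filter (fun s : Finset (Fin n) => StrictMonoOn g (s : Set (Fin n)))).sup Finset.card

lemma card_le_lisLength {α : Type*} [Preorder α] {g : Fin n → α} {s : Finset (Fin n)}
    (hs : StrictMonoOn g (s : Set (Fin n))) : s.card ≤ lisLength g := by
  classical
  exact Finset.le_sup (f := Finset.card) (by simpa using hs)

lemma exists_card_eq_lisLength {α : Type*} [Preorder α] (g : Fin n → α) :
    ∃ s : Finset (Fin n), StrictMonoOn g (s : Set (Fin n)) ∧ s.card = lisLength g := by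
  classical
  obtain ⟨s, hs, h⟩ := Finset.exists_mem_eq_sup (Finset.univ.filter
    (fun s : Finset (Fin n) => StrictMonoOn g (s : Set (Fin n)))) ⟨∅, by simp [StrictMonoOn]⟩
    Finset.card
  exact ⟨s, by simpa using hs, h.symm⟩

lemma lisLength_strictMono_comp {α β : Type*} [LinearOrder α] [Preorder β] {f : α → β}
    (hf : StrictMono f) (g : Fin n → α) : lisLength (f ∘ g) = lisLength g := by
  have : ∀ s : Set (Fin n), StrictMonoOn (f ∘ g) s ↔ StrictMonoOn g s := fun s =>
    ⟨fun h i hi j hj hij => hf.lt_iff_lt.1 (h hi hj hij),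
      fun h i hi j hj hij => hf (h hi hj hij)⟩
  unfold lisLength
  congr 1
  ext s
  simp [this]

lemma longestIncreasingSubsequence_eq (σ : Equiv.Perm (Fin n)) :
    longestIncreasingSubsequence σ = lisLength σ := by
  unfold longestIncreasingSubsequence lisLength
  congr!

/-- Rearranging an injective sequence in all possible ways gives all permutation patterns. -/
lemma sum_perm_lisLength_comp {α : Type*} [LinearOrder α] {g : Fin n → α} (hg : g.Injective)
    (F : ℕ → ℝ) : ∑ ρ : Equiv.Perm (Fin n), F (lisLength (g ∘ ρ)) =
      ∑ σ : Equiv.Perm (Fin n), F (lisLength σ) := by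
  have hmono : StrictMono (g ∘ Tuple.sort g) :=
    (Tuple.monotone_sort g).strictMono_of_injective (hg.comp (Tuple.sort g).injective)
  refine Fintype.sum_equiv (Equiv.mulLeft (Tuple.sort g)⁻¹) _ _ fun ρ => ?_
  rw [← lisLength_strictMono_comp hmono]
  congr 2
  ext i
  simp

/-- The pattern of a random permutation along a fixed injective sequence is uniform. -/
lemma sum_perm_lisLength {r : Fin n → Fin N} (hr : r.Injective) (F : ℕ → ℝ) :
    n.factorial * ∑ τ : Equiv.Perm (Fin N), F (lisLength (τ ∘ r)) =
      N.factorial * ∑ σ : Equiv.Perm (Fin n), F (lisLength σ) := by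
  have h1 : ∀ ρ : Equiv.Perm (Fin n), ∑ τ : Equiv.Perm (Fin N), F (lisLength (τ ∘ r ∘ ρ)) =
      ∑ τ : Equiv.Perm (Fin N), F (lisLength (τ ∘ r)) := by
    intro ρ
    -- The permutation ρ is carried to the range of `r`, where it can be absorbed into τ.
    refine Fintype.sum_equiv (Equiv.mulRight (ρ.viaFintypeEmbedding ⟨r, hr⟩)) _ _ fun τ => ?_
    congr 2
    ext i
    have := ρ.viaFintypeEmbedding_apply_image ⟨r, hr⟩ i
    simp only [Function.Embedding.coeFn_mk] at this
    simp [this]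
  have h2 : ∑ ρ : Equiv.Perm (Fin n), ∑ τ : Equiv.Perm (Fin N), F (lisLength (τ ∘ r ∘ ρ)) =
      n.factorial * ∑ τ : Equiv.Perm (Fin N), F (lisLength (τ ∘ r)) := by
    simp only [h1, Finset.sum_const, Finset.card_univ, Fintype.card_perm, Fintype.card_fin,
      nsmul_eq_mul]
  -- After the additional average over ρ, the inner sum for fixed τ runs over all rearrangements of
  -- an injective sequence, hence over all patterns once.
  rw [← h2, Finset.sum_comm]
  have h3 : ∀ τ : Equiv.Perm (Fin N), ∑ ρ : Equiv.Perm (Fin n), F (lisLength (τ ∘ r ∘ ρ)) =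
      ∑ σ : Equiv.Perm (Fin n), F (lisLength σ) := fun τ =>
    sum_perm_lisLength_comp (g := τ ∘ r) (τ.injective.comp hr) F
  simp only [h3, Finset.sum_const, Finset.card_univ, Fintype.card_perm, Fintype.card_fin,
    nsmul_eq_mul]

/-- With the cells listed by increasing column, a strictly increasing chain of cells is an
increasing subsequence of their rows. This half needs only that the listed cells be true; the next
needs that all true cells be listed. -/
lemma lisLength_le_gridHeight {x : Fin N × Fin N → Bool} {c r : Fin n → Fin N} (hc : StrictMono c)
    (hx : ∀ i, x (c i, r i) = true) : lisLength r ≤ gridHeight x := by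
  classical
  obtain ⟨s, hs, hcard⟩ := exists_card_eq_lisLength r
  let f : Fin n → ℕ × ℕ := fun i => ((c i).1, (r i).1)
  have hf : f.Injective := fun i j hij => hc.injective (Fin.ext (congrArg Prod.fst hij))
  rw [← hcard, ← Finset.card_image_of_injective s hf]
  refine card_le_bulk _ ?_ _ _ ?_
  · rw [Finset.coe_image]
    rintro _ ⟨i, hi, rfl⟩ _ ⟨j, hj, rfl⟩ hne
    have hij : i ≠ j := fun h => hne (h ▸ rfl)
    rcases lt_or_gt_of_ne hij with h | h
    · exact Or.inl ⟨hc h, hs hi hj h⟩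
    · exact Or.inr ⟨hc h, hs hj hi h⟩
  · intro z hz
    obtain ⟨i, -, rfl⟩ := Finset.mem_image.1 hz
    simp [extendField, f, hx]

lemma gridHeight_le_lisLength {x : Fin N × Fin N → Bool} {c r : Fin n → Fin N} (hc : StrictMono c)
    (hx : ∀ z, x z = true → ∃ i, z = (c i, r i)) : gridHeight x ≤ lisLength r := by
  classical
  obtain ⟨C, h1, h2, h3⟩ := exists_chain_card_eq_bulk (extendField x) N N
  let f : Fin n → ℕ × ℕ := fun i => ((c i).1, (r i).1)
  have hsub : C ⊆ (Finset.univ.filter fun i => f i ∈ C).image f := by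
    intro z hz
    obtain ⟨hξ, hi, hj⟩ := h2 z hz
    simp only [extendField, hi, hj, and_self, dif_pos] at hξ
    obtain ⟨i, hi'⟩ := hx _ hξ
    have hfi : f i = z := by
      have e1 := congrArg (fun z => (Prod.fst z).1) hi'
      have e2 := congrArg (fun z => (Prod.snd z).1) hi'
      exact Prod.ext e1.symm e2.symm
    exact Finset.mem_image.2 ⟨i, by simpa [hfi] using hz, hfi⟩
  rw [gridHeight, ← h3]
  refine (Finset.card_le_card hsub).trans (Finset.card_image_le.trans (card_le_lisLength ?_))
  intro i hi j hj hij
  have hi' : f i ∈ C := by simpa using hi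
  have hj' : f j ∈ C := by simpa using hj
  have hlt := hc hij
  have hne : f i ≠ f j := fun h => hlt.ne (Fin.ext (congrArg Prod.fst h))
  rcases h1 hi' hj' hne with h | h
  · exact h.2
  · exact absurd h.1 (not_lt.2 (le_of_lt hlt))

/-- No two cells of `A` are in the same row or column. -/
def IsMatchingSet (A : Finset (Fin N × Fin N)) : Prop :=
  ∀ a ∈ A, ∀ b ∈ A, a ≠ b → a.1 ≠ b.1 ∧ a.2 ≠ b.2

lemma IsMatchingSet.exists_enum {A : Finset (Fin N × Fin N)} (hA : IsMatchingSet A)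
    (hn : A.card = n) : ∃ c r : Fin n → Fin N, StrictMono c ∧ r.Injective ∧
      ∀ z, z ∈ A ↔ ∃ i, z = (c i, r i) := by
  have hinj : Set.InjOn Prod.fst (A : Set (Fin N × Fin N)) := fun a ha b hb hab => by
    by_contra hne
    exact (hA a ha b hb hne).1 hab
  have hcard : (A.image Prod.fst).card = n := by rw [Finset.card_image_of_injOn hinj, hn]
  let c := (A.image Prod.fst).orderEmbOfFin hcard
  have hex : ∀ i, ∃ j, (c i, j) ∈ A := fun i => by
    have := Finset.orderEmbOfFin_mem _ hcard i
    obtain ⟨z, hz, hzi⟩ := Finset.mem_image.1 this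
    exact ⟨z.2, by rw [show c i = z.1 from hzi.symm]; exact hz⟩
  choose r hr using hex
  refine ⟨c, r, c.strictMono, fun i j hij => ?_, fun z => ⟨fun hz => ?_, ?_⟩⟩
  · by_contra hne
    exact (hA _ (hr i) _ (hr j) fun h => hne (c.injective (congrArg Prod.fst h))).2 hij
  · have : z.1 ∈ Set.range c := by
      rw [Finset.range_orderEmbOfFin]
      exact Finset.mem_image_of_mem _ hz
    obtain ⟨i, hi⟩ := this
    refine ⟨i, ?_⟩
    by_contra hne
    exact (hA _ hz _ (hr i) hne).1 hi.symm
  · rintro ⟨i, rfl⟩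
    exact hr i

/-- Fewer than N cells leave a free column and a free row, whose intersection can be added. -/
lemma IsMatchingSet.exists_superset {A : Finset (Fin N × Fin N)} (hA : IsMatchingSet A)
    (hn : A.card ≤ n) (hN : n ≤ N) :
    ∃ B : Finset (Fin N × Fin N), A ⊆ B ∧ IsMatchingSet B ∧ B.card = n := by
  induction n, hn using Nat.le_induction with
  | base => exact ⟨A, subset_rfl, hA, rfl⟩
  | succ m _ ih =>
    obtain ⟨B, hAB, hB, hcard⟩ := ih (by omega)
    have hfree : ∀ f : Fin N × Fin N → Fin N, ∃ i, i ∉ B.image f := fun f => by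
      by_contra hcon
      push Not at hcon
      have h1 := Finset.card_le_card (fun i _ => hcon i : Finset.univ ⊆ B.image f)
      have h2 := Finset.card_image_le (s := B) (f := f)
      rw [Finset.card_univ, Fintype.card_fin] at h1
      omega
    obtain ⟨i, hi⟩ := hfree Prod.fst
    obtain ⟨j, hj⟩ := hfree Prod.snd
    have hi' : ∀ b ∈ B, b.1 ≠ i := fun b hb h => hi (Finset.mem_image.2 ⟨b, hb, h⟩)
    have hj' : ∀ b ∈ B, b.2 ≠ j := fun b hb h => hj (Finset.mem_image.2 ⟨b, hb, h⟩)
    refine ⟨insert (i, j) B, hAB.trans (Finset.subset_insert _ _), ?_, ?_⟩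
    · intro a ha b hb hab
      rcases Finset.mem_insert.1 ha with rfl | ha' <;> rcases Finset.mem_insert.1 hb with rfl | hb'
      · exact absurd rfl hab
      · exact ⟨(hi' b hb').symm, (hj' b hb').symm⟩
      · exact ⟨hi' a ha', hj' a ha'⟩
      · exact hB a ha' b hb' hab
    · rw [Finset.card_insert_of_notMem fun h => hi' _ h rfl, hcard]

end Subsequences

/-! ### Comparison of uniform permutations with Bernoulli fields -/

section Depoissonization

variable {n N : ℕ}

/-- The proportion of permutations the length of whose longest increasing subsequence is in `A`. -/
noncomputable def permFraction (n : ℕ) (A : Set ℕ) : ℝ :=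
  (∑ σ : Equiv.Perm (Fin n), A.indicator (1 : ℕ → ℝ) (lisLength σ)) / n.factorial

lemma permFraction_nonneg (n : ℕ) (A : Set ℕ) : 0 ≤ permFraction n A :=
  div_nonneg (Finset.sum_nonneg fun _ _ => Set.indicator_nonneg (fun _ _ => zero_le_one) _)
    (Nat.cast_nonneg _)

/-- The set of cells where the field does not vanish. -/
def fieldSupport (x : Fin N × Fin N → Bool) : Finset (Fin N × Fin N) :=
  Finset.univ.filter fun z => x z = true

lemma mem_fieldSupport {x : Fin N × Fin N → Bool} {z : Fin N × Fin N} :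
    z ∈ fieldSupport x ↔ x z = true := by simp [fieldSupport]

/-- The field with its rows permuted. -/
def permuteRows (τ : Equiv.Perm (Fin N)) (x : Fin N × Fin N → Bool) : Fin N × Fin N → Bool :=
  x ∘ Prod.map id τ.symm

/-- Permuting the rows leaves the law of the field unchanged, so the right side may be averaged over
all τ. For a fixed field in `G`, the pattern of τ ∘ r under uniform τ is a uniform permutation of n
elements, so at least a proportion `permFraction n A` of the τ realises the event. -/
lemma permFraction_mul_measureReal_le (p : unitInterval) (A : Set ℕ)
    (G : Set (Fin N × Fin N → Bool))
    (hG : ∀ x ∈ G, ∃ r : Fin n → Fin N, r.Injective ∧ ∀ τ : Equiv.Perm (Fin N),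
      lisLength (τ ∘ r) ∈ A → gridHeight (permuteRows τ x) ∈ A) :
    permFraction n A * (bernoulliField fun _ : Fin N × Fin N => p).real G ≤
      (bernoulliField fun _ : Fin N × Fin N => p).real {x | gridHeight x ∈ A} := by
  set μ := bernoulliField fun _ : Fin N × Fin N => p with hμ
  have hfact : (0 : ℝ) < N.factorial := Nat.cast_pos.2 N.factorial_pos
  have hfact' : (n.factorial : ℝ) ≠ 0 := Nat.cast_ne_zero.2 n.factorial_ne_zero
  have hind : ∀ x ∈ G, N.factorial * permFraction n A ≤
      ∑ τ : Equiv.Perm (Fin N), A.indicator (1 : ℕ → ℝ) (gridHeight (permuteRows τ x)) := by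
    intro x hx
    obtain ⟨r, hr, h⟩ := hG x hx
    have h1 := sum_perm_lisLength hr (A.indicator (1 : ℕ → ℝ))
    have h2 : N.factorial * permFraction n A =
        ∑ τ : Equiv.Perm (Fin N), A.indicator (1 : ℕ → ℝ) (lisLength (τ ∘ r)) := by
      rw [permFraction, ← mul_div_assoc, ← h1, mul_div_cancel_left₀ _ hfact']
    rw [h2]
    refine Finset.sum_le_sum fun τ _ => ?_
    by_cases hA : lisLength (τ ∘ r) ∈ A
    · simp [hA, h τ hA]
    · rw [Set.indicator_of_notMem hA]
      exact Set.indicator_nonneg (fun _ _ => zero_le_one) _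
  have hinv : ∀ τ : Equiv.Perm (Fin N),
      ∫ x, A.indicator (1 : ℕ → ℝ) (gridHeight (permuteRows τ x)) ∂μ =
        μ.real {x | gridHeight x ∈ A} := by
    intro τ
    have h1 := bernoulliField_real_comp (fun _ : Fin N × Fin N => p)
      (e := Prod.map id τ.symm) (Function.injective_id.prodMap τ.symm.injective)
      {x | gridHeight x ∈ A}
    refine Eq.trans ?_ h1
    rw [← integral_indicator_one .of_discrete]
    rfl
  have h3 : ∫ x, G.indicator (fun _ => N.factorial * permFraction n A) x ∂μ ≤
      ∫ x, ∑ τ : Equiv.Perm (Fin N), A.indicator (1 : ℕ → ℝ) (gridHeight (permuteRows τ x)) ∂μ := by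
    refine integral_mono .of_finite .of_finite fun x => ?_
    by_cases hx : x ∈ G
    · simpa [hx] using hind x hx
    · rw [Set.indicator_of_notMem hx]
      exact Finset.sum_nonneg fun _ _ => Set.indicator_nonneg (fun _ _ => zero_le_one) _
  rw [integral_finsetSum _ fun _ _ => .of_finite, integral_indicator_const _ .of_discrete] at h3
  simp only [hinv, Finset.sum_const, Finset.card_univ, Fintype.card_perm, Fintype.card_fin,
    nsmul_eq_mul, smul_eq_mul] at h3
  refine le_of_mul_le_mul_left ?_ hfact
  linarith

/-- A matching with at least n cells contains one with exactly n, and deleting cells can only lower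
the height. The next lemma adds cells instead. -/
lemma permFraction_ge_mul_le (p : unitInterval) (t : ℝ) :
    permFraction n {m | t ≤ m} * (bernoulliField fun _ : Fin N × Fin N => p).real
        {x | IsMatchingSet (fieldSupport x) ∧ n ≤ (fieldSupport x).card} ≤
      (bernoulliField fun _ : Fin N × Fin N => p).real {x | t ≤ gridHeight x} := by
  refine permFraction_mul_measureReal_le p {m : ℕ | t ≤ m} _ fun x hx => ?_
  obtain ⟨A, hA, hcard⟩ := Finset.exists_subset_card_eq hx.2
  have hm : IsMatchingSet A := fun a ha b hb => hx.1 a (hA ha) b (hA hb)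
  obtain ⟨c, r, hc, hr, hcr⟩ := hm.exists_enum hcard
  refine ⟨r, hr, fun τ hτ => le_trans hτ.out
    (Nat.cast_le.2 (lisLength_le_gridHeight hc fun i => ?_))⟩
  have : x (c i, r i) = true := mem_fieldSupport.1 (hA ((hcr _).2 ⟨i, rfl⟩))
  simpa [permuteRows] using this

lemma permFraction_le_mul_le (p : unitInterval) (t : ℝ) (hN : n ≤ N) :
    permFraction n {m | (m : ℝ) ≤ t} * (bernoulliField fun _ : Fin N × Fin N => p).real
        {x | IsMatchingSet (fieldSupport x) ∧ (fieldSupport x).card ≤ n} ≤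
      (bernoulliField fun _ : Fin N × Fin N => p).real {x | (gridHeight x : ℝ) ≤ t} := by
  refine permFraction_mul_measureReal_le p {m : ℕ | (m : ℝ) ≤ t} _ fun x hx => ?_
  obtain ⟨A, hA, hm, hcard⟩ := hx.1.exists_superset hx.2 hN
  obtain ⟨c, r, hc, hr, hcr⟩ := hm.exists_enum hcard
  refine ⟨r, hr, fun τ hτ => le_trans
    (Nat.cast_le.2 (gridHeight_le_lisLength hc fun z hz => ?_)) hτ.out⟩
  obtain ⟨i, hi⟩ := (hcr _).1 (hA (mem_fieldSupport.2 hz))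
  have h1 : z.1 = c i := congrArg Prod.fst hi
  have h2 : τ.symm z.2 = r i := congrArg Prod.snd hi
  exact ⟨i, Prod.ext h1 ((Equiv.symm_apply_eq τ).1 h2)⟩

lemma measureReal_two_cells {ι : Type*} [Fintype ι] (p : unitInterval) {a b : ι} (hab : a ≠ b) :
    (bernoulliField fun _ : ι => p).real {x | x a = true ∧ x b = true} = (p : ℝ) ^ 2 := by
  have hi : IndepFun (fun x : ι → Bool => x a) (fun x => x b) (bernoulliField fun _ : ι => p) :=
    (iIndepFun_pi (μ := fun _ : ι => bernoulliMeasure true false p) (X := fun _ v => v)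
      fun _ => measurable_id.aemeasurable).indepFun hab
  have h1 : ∀ i : ι, (bernoulliField fun _ : ι => p).real ((fun x => x i) ⁻¹' {true}) = p := by
    intro i
    rw [← map_measureReal_apply (measurable_of_finite _) .of_discrete,
      show (bernoulliField fun _ : ι => p).map (fun x => x i) = bernoulliMeasure true false p from
        (measurePreserving_eval (fun _ : ι => bernoulliMeasure true false p) i).map_eq]
    simp
  have h2 := hi.measure_inter_preimage_eq_mul {true} {true} .of_discrete .of_discrete
  have h3 := congrArg ENNReal.toReal h2
  rw [ENNReal.toReal_mul] at h3
  simp only [← measureReal_def] at h3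
  rw [h1, h1, ← sq] at h3
  exact h3

/-- Union bound over the N³ triples for a common column and the N³ for a common row, each requiring
two distinct true cells. -/
lemma measureReal_not_isMatchingSet_le (p : unitInterval) :
    (bernoulliField fun _ : Fin N × Fin N => p).real {x | ¬ IsMatchingSet (fieldSupport x)} ≤
      2 * (N : ℝ) ^ 3 * p ^ 2 := by
  set μ := bernoulliField fun _ : Fin N × Fin N => p with hμ
  let E : (Fin N × Fin N × Fin N) ⊕ (Fin N × Fin N × Fin N) → Set (Fin N × Fin N → Bool)
    | .inl (i, j, k) => {x | j ≠ k ∧ x (i, j) = true ∧ x (i, k) = true}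
    | .inr (i, j, k) => {x | j ≠ k ∧ x (j, i) = true ∧ x (k, i) = true}
  have hE : ∀ e, μ.real (E e) ≤ (p : ℝ) ^ 2 := by
    rintro (⟨i, j, k⟩ | ⟨i, j, k⟩)
    all_goals
      by_cases hjk : j = k
      · simp only [E, hjk, ne_eq, not_true_eq_false, false_and]
        rw [Set.ofPred_false, measureReal_empty]
        positivity
      · simp only [E, ne_eq, hjk, not_false_eq_true, true_and]
        exact (measureReal_two_cells p (by simpa using hjk)).le
  have hsub : {x | ¬ IsMatchingSet (fieldSupport x)} ⊆ ⋃ e, E e := by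
    intro x hx
    have hx' : ¬ IsMatchingSet (fieldSupport x) := hx
    simp only [IsMatchingSet, mem_fieldSupport, not_forall, not_and_or, not_not] at hx'
    obtain ⟨⟨a1, a2⟩, ha, ⟨b1, b2⟩, hb, hne, h⟩ := hx'
    rw [Set.mem_iUnion]
    rcases h with h | h
    · have h' : a1 = b1 := h
      subst h'
      exact ⟨.inl (a1, a2, b2), fun h => hne (by rw [h]), ha, hb⟩
    · have h' : a2 = b2 := h
      subst h'
      exact ⟨.inr (a2, a1, b1), fun h => hne (by rw [h]), ha, hb⟩
  calc _ ≤ μ.real (⋃ e, E e) := measureReal_mono hsub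
    _ ≤ ∑ e, μ.real (E e) := measureReal_iUnion_fintype_le _
    _ ≤ ∑ _e : (Fin N × Fin N × Fin N) ⊕ (Fin N × Fin N × Fin N), (p : ℝ) ^ 2 :=
      Finset.sum_le_sum fun e _ => hE e
    _ = _ := by
      simp only [Finset.sum_const, Finset.card_univ, Fintype.card_sum, Fintype.card_prod,
        Fintype.card_fin, nsmul_eq_mul]
      push_cast
      ring

lemma measureReal_card_fieldSupport_le (p : unitInterval) {c : ℝ} (hc : 0 < c) :
    (bernoulliField fun _ : Fin N × Fin N => p).real
      {x | c ≤ |((fieldSupport x).card : ℝ) - N ^ 2 * p|} ≤ N ^ 2 * p / c ^ 2 := by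
  have h := measureReal_sum_sub_ge_le (fun _ : Fin N × Fin N => p) Finset.univ hc
  have h1 : ∀ x : Fin N × Fin N → Bool,
      ∑ i, ((x i).toNat : ℝ) = (fieldSupport x).card := fun x => by
    rw [fieldSupport, Finset.card_filter]
    push_cast
    exact Finset.sum_congr rfl fun i _ => by cases x i <;> simp
  have h2 : ∑ _i : Fin N × Fin N, (p : ℝ) = N ^ 2 * p := by simp [sq]
  simpa only [h1, h2] using h

end Depoissonization

/-! ### The Ulam constant -/

section UlamConstant

lemma exists_prob_eq {n : ℕ} (hn : 2 ≤ n) {a : ℝ} (ha : 0 ≤ a) (ha2 : a ≤ 2) :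
    ∃ p : unitInterval, (p : ℝ) = a * n / ((n ^ 3 : ℕ) : ℝ) ^ 2 := by
  refine ⟨⟨a * n / ((n ^ 3 : ℕ) : ℝ) ^ 2, by positivity, ?_⟩, rfl⟩
  have h2 : (2 : ℝ) ≤ n := by exact_mod_cast hn
  refine div_le_one_of_le₀ ?_ (by positivity)
  push_cast
  calc a * n ≤ 2 * n := by gcongr
    _ ≤ n * n := by gcongr
    _ = n ^ 2 * 1 := by ring
    _ ≤ n ^ 2 * n ^ 4 := by gcongr; exact one_le_pow₀ (by linarith)
    _ = _ := by ring

/-- With high probability, a field of mean size `a n` on a grid of side `n ^ 3` is a matching and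
its size is close to its mean. -/
lemma one_sub_le_measureReal_matching {n : ℕ} (hn : 2 ≤ n) {a : ℝ} (ha : 0 ≤ a) (ha2 : a ≤ 2)
    {p : unitInterval} (hp : (p : ℝ) = a * n / ((n ^ 3 : ℕ) : ℝ) ^ 2) {δ : ℝ} (hδ : 0 < δ)
    (Q : ℕ → Prop) (hQ : ∀ m : ℕ, |(m : ℝ) - a * n| < δ * n → Q m) :
    1 - (8 + 2 / δ ^ 2) / n ≤ (bernoulliField fun _ : Fin (n ^ 3) × Fin (n ^ 3) => p).real
      {x | IsMatchingSet (fieldSupport x) ∧ Q (fieldSupport x).card} := by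
  have hn0 : (0 : ℝ) < n := Nat.cast_pos.2 (by omega)
  set μ := bernoulliField fun _ : Fin (n ^ 3) × Fin (n ^ 3) => p with hμ
  have hmean : ((n ^ 3 : ℕ) : ℝ) ^ 2 * p = a * n := by
    rw [hp]; push_cast; field_simp
  -- The collision bound 2N³p² equals 2a²n²/N; the side N = n³ makes it 2a²/n.
  have h1 : μ.real {x | ¬ IsMatchingSet (fieldSupport x)} ≤ 8 / n := by
    refine (measureReal_not_isMatchingSet_le p).trans ?_
    rw [hp]
    push_cast
    rw [show 2 * ((n : ℝ) ^ 3) ^ 3 * (a * n / ((n : ℝ) ^ 3) ^ 2) ^ 2 = 2 * a ^ 2 / n by field_simp]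
    gcongr
    nlinarith
  have h2 : μ.real {x | δ * n ≤ |((fieldSupport x).card : ℝ) - a * n|} ≤ 2 / δ ^ 2 / n := by
    have h3 := measureReal_card_fieldSupport_le (N := n ^ 3) p (c := δ * n) (by positivity)
    rw [hmean] at h3
    refine h3.trans ?_
    rw [show a * n / (δ * n) ^ 2 = a / δ ^ 2 / n by field_simp]
    gcongr
  have h3 : (1 : ℝ) ≤ μ.real {x | IsMatchingSet (fieldSupport x) ∧ Q (fieldSupport x).card} +
      (8 / n + 2 / δ ^ 2 / n) := by
    rw [← probReal_univ (μ := μ)]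
    refine le_trans (measureReal_mono fun x _ => ?_) ((measureReal_union_le _ _).trans
      (add_le_add le_rfl ((measureReal_union_le _ _).trans (add_le_add h1 h2))))
    by_contra hcon
    simp only [Set.mem_union, Set.mem_ofPred_eq, not_or, not_not, not_le, not_and] at hcon
    exact hcon.1 hcon.2.1 (hQ _ hcon.2.2)
  rw [add_div]
  linarith

lemma le_two_mul_of_mul_le {a b c : ℝ} (ha : 0 ≤ a) (hb : 1 / 2 ≤ b) (h : a * b ≤ c) :
    a ≤ 2 * c := by nlinarith

lemma eventually_half_le (b : ℝ) : ∀ᶠ n : ℕ in atTop, 1 / 2 ≤ 1 - b / (n : ℝ) := by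
  have h : Tendsto (fun n : ℕ => 1 - b / (n : ℝ)) atTop (𝓝 (1 - 0)) :=
    (tendsto_natCast_atTop_atTop.const_div_atTop b).const_sub 1
  exact h.eventually_const_le (by norm_num)

/-- The field has mean size (1 + δ)n, so with high probability it has at least n cells. The
resulting loss is absorbed by (2 + δ)(1 + δ) ≤ 2 + 4δ ≤ 2 + ε. -/
lemma tendsto_permFraction_ge {ε : ℝ} (hε : 0 < ε) :
    Tendsto (fun n : ℕ => permFraction n {m | (2 + ε) * √n ≤ m}) atTop (𝓝 0) := by
  set δ := min (ε / 4) 1 with hδdef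
  have hδ : 0 < δ := by positivity
  have hδ1 : δ ≤ 1 := min_le_right _ _
  have hδε : 4 * δ ≤ ε := by have := min_le_left (ε / 4) (1 : ℝ); linarith
  refine squeeze_zero' (Eventually.of_forall fun n => permFraction_nonneg _ _) ?_
    (tendsto_const_div_mul_sqrt 16 (δ ^ 2) (by positivity))
  filter_upwards [eventually_ge_atTop 2, eventually_half_le (8 + 2 / δ ^ 2)] with n hn hhalf
  have hn0 : (0 : ℝ) < n := Nat.cast_pos.2 (by omega)
  have hsq : (0 : ℝ) < √n := Real.sqrt_pos.2 hn0
  obtain ⟨p, hp⟩ := exists_prob_eq hn (a := 1 + δ) (by linarith) (by linarith)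
  have hG := one_sub_le_measureReal_matching hn (by linarith) (by linarith) hp hδ
    (fun m => n ≤ m) fun m hm => by
      have := (abs_lt.1 hm).1
      have h1 : (n : ℝ) < m := by linarith
      exact_mod_cast h1.le
  have hN0 : (0 : ℝ) < (n ^ 3 : ℕ) := by positivity
  have hqN : √((1 + δ) * n) / (n ^ 3 : ℕ) * (n ^ 3 : ℕ) = √((1 + δ) * n) :=
    div_mul_cancel₀ _ hN0.ne'
  have hq2 : (√((1 + δ) * n) / (n ^ 3 : ℕ)) ^ 2 = (p : ℝ) := by
    rw [div_pow, Real.sq_sqrt (by positivity), hp]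
  have hupper := measureReal_gridHeight_ge_le (p := p) (N := n ^ 3)
    (q := √((1 + δ) * n) / (n ^ 3 : ℕ)) (by positivity) hq2 (by positivity) hδ
  rw [hqN] at hupper
  have h1 : √n ≤ √((1 + δ) * n) := Real.sqrt_le_sqrt (by nlinarith)
  have h2 : √((1 + δ) * n) ≤ (1 + δ) * √n := by
    rw [Real.sqrt_mul (by linarith)]
    gcongr
    rw [Real.sqrt_le_left (by linarith)]
    nlinarith
  have h3 : (2 + δ) * √((1 + δ) * n) ≤ (2 + ε) * √n := by
    calc _ ≤ (2 + δ) * ((1 + δ) * √n) := by gcongr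
      _ = ((2 + δ) * (1 + δ)) * √n := by ring
      _ ≤ _ := by gcongr; nlinarith
  have h4 := (permFraction_ge_mul_le (n := n) p ((2 + ε) * √n)).trans
    ((measureReal_mono fun x hx => le_trans h3 hx).trans hupper)
  refine (le_two_mul_of_mul_le (permFraction_nonneg _ _) (hhalf.trans hG) h4).trans ?_
  rw [show 16 / (δ ^ 2 * √n) = 2 * (8 / (δ ^ 2 * √n)) by ring]
  gcongr

/-- Here the mean size is (1 - δ)n, so the field extends to a matching of n cells, and (2 - 6δ)(1 -
δ) ≥ 2 - 8δ ≥ 2 - ε. -/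
lemma tendsto_permFraction_le {ε : ℝ} (hε : 0 < ε) :
    Tendsto (fun n : ℕ => permFraction n {m | (m : ℝ) ≤ (2 - ε) * √n}) atTop (𝓝 0) := by
  set δ := min (ε / 8) (1 / 4) with hδdef
  have hδ : 0 < δ := by positivity
  have hδ1 : δ ≤ 1 / 4 := min_le_right _ _
  have hδε : 8 * δ ≤ ε := by have := min_le_left (ε / 8) (1 / 4 : ℝ); linarith
  refine squeeze_zero' (Eventually.of_forall fun n => permFraction_nonneg _ _) ?_
    (tendsto_const_div_mul_sqrt 3600 (δ ^ 4) (by positivity))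
  have hlarge : ∀ᶠ n : ℕ in atTop, 12 / δ ^ 2 ≤ √(n : ℝ) :=
    tendsto_sqrt_natCast.eventually_ge_atTop _
  filter_upwards [eventually_ge_atTop 2, eventually_half_le (8 + 2 / δ ^ 2), hlarge]
    with n hn hhalf hlarge
  have hn2 : (2 : ℝ) ≤ n := by exact_mod_cast hn
  have hn0 : (0 : ℝ) < n := by linarith
  have hsq : (0 : ℝ) < √n := Real.sqrt_pos.2 hn0
  obtain ⟨p, hp⟩ := exists_prob_eq hn (a := 1 - δ) (by linarith) (by linarith)
  have hG := one_sub_le_measureReal_matching hn (by linarith) (by linarith) hp hδ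
    (fun m => m ≤ n) fun m hm => by
      have := (abs_lt.1 hm).2
      have h1 : (m : ℝ) < n := by linarith
      exact_mod_cast h1.le
  have hN0 : (0 : ℝ) < (n ^ 3 : ℕ) := by positivity
  have ha0 : 0 < 1 - δ := by linarith
  have hqN : √((1 - δ) * n) / (n ^ 3 : ℕ) * (n ^ 3 : ℕ) = √((1 - δ) * n) :=
    div_mul_cancel₀ _ hN0.ne'
  have hq2 : (√((1 - δ) * n) / (n ^ 3 : ℕ)) ^ 2 = (p : ℝ) := by
    rw [div_pow, Real.sq_sqrt (by positivity), hp]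
  have h1 : √((1 - δ) * n) ≤ √n := Real.sqrt_le_sqrt (by nlinarith)
  have h2 : (1 - δ) * √n ≤ √((1 - δ) * n) := by
    rw [Real.sqrt_mul ha0.le]
    gcongr
    rw [Real.le_sqrt' ha0]
    nlinarith
  have hqδ : √((1 - δ) * n) / (n ^ 3 : ℕ) ≤ δ ^ 2 / 12 := by
    have h5 : √(n : ℝ) * √n = n := Real.mul_self_sqrt hn0.le
    have h6 : 12 ≤ √(n : ℝ) * δ ^ 2 := (div_le_iff₀ (by positivity)).1 hlarge
    rw [div_le_div_iff₀ hN0 (by norm_num)]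
    push_cast
    calc √((1 - δ) * n) * 12 ≤ √n * (√(n : ℝ) * δ ^ 2) := by gcongr
      _ = δ ^ 2 * n := by rw [← mul_assoc, h5, mul_comm]
      _ ≤ δ ^ 2 * n ^ 3 := by
        gcongr
        exact le_self_pow₀ (by linarith) (by norm_num)
  have hR : 1 ≤ √((1 - δ) * n) := by
    rw [Real.le_sqrt' one_pos]
    nlinarith
  have hlower := measureReal_gridHeight_le_le (p := p) (N := n ^ 3)
    (q := √((1 - δ) * n) / (n ^ 3 : ℕ)) (by positivity) hq2 hδ hδ1 hqδ (by rwa [hqN])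
  rw [hqN] at hlower
  have h3 : (2 - ε) * √n ≤ (2 - 6 * δ) * √((1 - δ) * n) := by
    calc _ ≤ ((2 - 6 * δ) * (1 - δ)) * √n := by gcongr; nlinarith
      _ = (2 - 6 * δ) * ((1 - δ) * √n) := by ring
      _ ≤ _ := by
        have : 0 ≤ 2 - 6 * δ := by linarith
        gcongr
  have h4 := (permFraction_le_mul_le p ((2 - ε) * √n) (Nat.le_self_pow (by norm_num) n)).trans
    ((measureReal_mono fun x hx => le_trans hx h3).trans hlower)
  refine (le_two_mul_of_mul_le (permFraction_nonneg _ _) (hhalf.trans hG) h4).trans ?_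
  -- Accounts for the constant 3600 = 2 · 2 · 900: one factor 2 from the matching probability, one
  -- from this bound.
  have h5 : 1 / 2 * √n ≤ √((1 - δ) * n) := le_trans (by gcongr; linarith) h2
  calc 2 * (900 / (δ ^ 4 * √((1 - δ) * n))) ≤ 2 * (900 / (δ ^ 4 * (1 / 2 * √n))) := by gcongr
    _ = _ := by field_simp; norm_num

lemma card_div_factorial_le_permFraction {n : ℕ} {p : ℕ → Prop} {A B : Set ℕ}
    (h : ∀ m, p m → m ∈ A ∨ m ∈ B) :
    (Nat.card {σ : Equiv.Perm (Fin n) // p (longestIncreasingSubsequence σ)} : ℝ) /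
      (Nat.factorial n : ℝ) ≤ permFraction n A + permFraction n B := by
  classical
  rw [permFraction, permFraction, ← add_div, ← Finset.sum_add_distrib, Nat.card_eq_fintype_card,
    Fintype.card_subtype, Finset.card_filter]
  push_cast
  gcongr with σ
  rw [longestIncreasingSubsequence_eq]
  have hA : 0 ≤ A.indicator (1 : ℕ → ℝ) (lisLength σ) :=
    Set.indicator_nonneg (fun _ _ => zero_le_one) _
  have hB : 0 ≤ B.indicator (1 : ℕ → ℝ) (lisLength σ) :=
    Set.indicator_nonneg (fun _ _ => zero_le_one) _
  split_ifs with hp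
  · rcases h _ hp with h1 | h1
    · rw [Set.indicator_of_mem h1, Pi.one_apply]; linarith
    · rw [Set.indicator_of_mem h1 (1 : ℕ → ℝ), Pi.one_apply]; linarith
  · linarith

/-- The longest increasing subsequence of a uniformly random permutation. -/
theorem tendsto_longestIncreasingSubsequence {ε : ℝ} (hε : 0 < ε) :
    Tendsto (fun n : ℕ =>
      (Nat.card {σ : Equiv.Perm (Fin n) //
          ε ≤ |(longestIncreasingSubsequence σ : ℝ) / Real.sqrt n - 2|} : ℝ) /
        (Nat.factorial n : ℝ)) atTop (𝓝 0) := by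
  have hlim := (tendsto_permFraction_ge hε).add (tendsto_permFraction_le hε)
  rw [add_zero] at hlim
  refine squeeze_zero' (Eventually.of_forall fun n => by positivity) ?_ hlim
  filter_upwards [eventually_ge_atTop 1] with n hn
  have hsq : (0 : ℝ) < √n := Real.sqrt_pos.2 (Nat.cast_pos.2 hn)
  refine card_div_factorial_le_permFraction
    (p := fun m : ℕ => ε ≤ |(m : ℝ) / Real.sqrt n - 2|) fun m hm => ?_
  rcases le_abs'.1 hm with h1 | h1
  · right
    have h2 : (m : ℝ) / √n ≤ 2 - ε := by linarith
    exact (div_le_iff₀ hsq).1 h2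
  · left
    have h2 : 2 + ε ≤ (m : ℝ) / √n := by linarith
    exact (le_div_iff₀ hsq).1 h2

end UlamConstant

theorem mainTheorem4 :
    (∀ (Ω : ℕ → Type*) [∀ n, MeasurableSpace (Ω n)]
        (P : ∀ n, Measure (Ω n)) [∀ n, IsProbabilityMeasure (P n)]
        (Ξ : ∀ n, Ω n → Set (ℝ × ℝ)),
        (∀ n, 1 ≤ n → IsPoissonProcess (P n) (Ξ n) (squareIntensity n)) →
        (∀ ε : ℝ, 0 < ε →
          Tendsto (fun n : ℕ =>
            P n {ω | ε ≤ |longestIncreasingPath (Ξ n ω) / Real.sqrt n - 2|}) atTop (𝓝 0)) ∧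
        (∀ n, 1 ≤ n → Integrable (fun ω => longestIncreasingPath (Ξ n ω)) (P n)) ∧
        Tendsto (fun n : ℕ =>
          (∫ ω, longestIncreasingPath (Ξ n ω) ∂(P n)) / Real.sqrt n) atTop (𝓝 2)) ∧
    (∀ ε : ℝ, 0 < ε →
      Tendsto (fun n : ℕ =>
        (Nat.card {σ : Equiv.Perm (Fin n) //
            ε ≤ |(longestIncreasingSubsequence σ : ℝ) / Real.sqrt n - 2|} : ℝ) /
          (Nat.factorial n : ℝ)) atTop (𝓝 0)) :=
  ⟨fun _ _ _ _ _ h => ⟨fun _ hε => tendsto_measure_longestIncreasingPath h hε,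
    fun n hn => (h n hn).integrable_longestIncreasingPath,
    tendsto_integral_longestIncreasingPath h⟩,
    fun _ hε => tendsto_longestIncreasingSubsequence hε⟩
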